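/- Let $R$ be a commutative ring with identity. An $R$-module $M$ is *Gorenstein flat* if there is an exact sequence $\cdots\to F_1\to F_0\to F^0\to F^1\to\cdots$ of flat $R$-modules with $M\cong\operatorname{im}(F_0\to F^0)$ that stays exact under $I\otimes_R-$ for every injective $R$-module $I$. Call $R$ *GF-closed* if the class of Gorenstein flat $R$-modules is closed under extensions. Let $C$ be a semidualizing $R$-module, that is, $C$ has a resolution by finitely generated projective modules, the homothety map $R\to\operatorname{Hom}_R(C,C)$ is an isomorphism, and $\operatorname{Ext}_R^{i}(C,C)=0$ for all $i\ge 1$. - $\mathcal{GF}_C(R)$ is the class of $G_C$-flat modules: those $M$ for which there is an exact sequence $\cdots\to F_1\to F_0\to C\otimes_R F^0\to C\otimes_R F^1\to\cdots$ with all $F_i,F^i$ flat and $M\cong\operatorname{im}(F_0\to C\otimes_R F^0)$ that stays exact under $\operatorname{Hom}_R(C,I)\otimes_R-$ for every injective $R$-module $I$. - $\mathcal B_C(R)$ is the Bass class: those $N$ such that $\operatorname{Ext}^{i}_R(C,N)=0=\operatorname{Tor}^R_{i}(C,\operatorname{Hom}_R(C,N))$ for all $i\ge1$ and the evaluation map $C\otimes_R\operatorname{Hom}_R(C,N)\to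 N$ is an isomorphism. For $\mathcal X=\mathcal{GF}_C(R)\cap\mathcal B_C(R)$ put $\mathcal G^1(\mathcal X)=\mathcal X$, and for $n\ge2$ let $\mathcal G^n(\mathcal X)$ be the class of all $R$-modules $M$ for which there is an exact sequence $\cdots\to G_1\to G_0\to G^0\to G^1\to\cdots$ of modules in $\mathcal G^{n-1}(\mathcal X)$ with $M\cong\operatorname{im}(G_0\to G^0)$ that stays exact under $\operatorname{Hom}_R(A,-)$ and under $A^+\otimes_R-$ for every $A\in\mathcal G^{n-1}(\mathcal X)$, where $A^+=\operatorname{Hom}_{\mathbb Z}(A,\mathbb Q/\mathbb Z)$. If $R$ is GF-closed, then $$\mathcal G^n\bigl(\mathcal{GF}_C(R)\cap\mathcal B_C(R)\bigr)=\mathcal{GF}_C(R)\cap\mathcal B_C(R)\qquad\text{for all } n\ge1.$$ -/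

import Mathlib

open CategoryTheory

universe u

namespace GorFlat

/-- A doubly infinite exact sequence of `R`-modules
`⋯ ⟶ X (-1) ⟶ X 0 ⟶ X 1 ⟶ X 2 ⟶ ⋯`, where `d i : X i ⟶ X (i + 1)`.
In the notation `⋯ ⟶ G₁ ⟶ G₀ ⟶ G⁰ ⟶ G¹ ⟶ ⋯` one has `Gᵢ = X (-i)` and `Gⁱ = X (1 + i)`. -/
structure ExactSeq (R : Type u) [CommRing R] where
  X : ℤ → ModuleCat.{u} R
  d : ∀ i : ℤ, X i →ₗ[R] X (i + 1)
  exact : ∀ i : ℤ, Function.Exact (d i) (d (i + 1))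

namespace ExactSeq

variable {R : Type u} [CommRing R]

/-- The sequence stays exact under `Hom_R(A, -)`. -/
def HomExact (S : ExactSeq R) (A : Type u) [AddCommGroup A] [Module R A] : Prop :=
  ∀ i : ℤ, Function.Exact (fun f : A →ₗ[R] S.X i => S.d i ∘ₗ f)
    (fun f : A →ₗ[R] S.X (i + 1) => S.d (i + 1) ∘ₗ f)

/-- The sequence stays exact under `A ⊗_R -`. -/
def TensorExact (S : ExactSeq R) (A : Type u) [AddCommGroup A] [Module R A] : Prop :=
  ∀ i : ℤ, Function.Exact ((S.d i).lTensor A) ((S.d (i + 1)).lTensor A)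

/-- `M ≅ im (G₀ ⟶ G⁰)`. -/
def HasImage (S : ExactSeq R) (M : Type u) [AddCommGroup M] [Module R M] : Prop :=
  Nonempty (M ≃ₗ[R] LinearMap.range (S.d 0))

end ExactSeq

/-- The class of Gorenstein flat `R`-modules. -/
def GorensteinFlat (R : Type u) [CommRing R] : ObjectProperty (ModuleCat.{u} R) := fun M =>
  ∃ S : ExactSeq R, (∀ i, Module.Flat R (S.X i)) ∧ S.HasImage M ∧
    ∀ (I : Type u) [AddCommGroup I] [Module R I], Module.Injective R I → S.TensorExact I

/-- `R` is GF-closed: the class of Gorenstein flat modules is closed under extensions. -/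
def IsGFClosed (R : Type u) [CommRing R] : Prop :=
  (GorensteinFlat R).IsClosedUnderExtensions

section Semidualizing

variable (R : Type u) [CommRing R] (C : Type u) [AddCommGroup C] [Module R C]

/-- `C` is a semidualizing `R`-module: it has a resolution by finitely generated projective
modules, the homothety map `R → Hom_R(C, C)` is an isomorphism, and `Ext^i_R(C, C) = 0` for
all `i ≥ 1`. -/
structure IsSemidualizing : Prop where
  exists_resolution : ∃ P : ProjectiveResolution (ModuleCat.of R C),
    ∀ n : ℕ, Module.Finite R (P.complex.X n)
  homothety_bijective : Function.Bijective (LinearMap.lsmul R C : R →ₗ[R] C →ₗ[R] C)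
  ext_eq_zero : ∀ n : ℕ, 1 ≤ n →
    Subsingleton (Abelian.Ext (ModuleCat.of R C) (ModuleCat.of R C) n)

/-- The class `F_C(R)` of `C`-flat modules: those isomorphic to `C ⊗ F` with `F` flat. -/
def CFlat : ObjectProperty (ModuleCat.{u} R) := fun M =>
  ∃ F : ModuleCat.{u} R, Module.Flat R F ∧ Nonempty (M ≃ₗ[R] TensorProduct R C F)

/-- The class `I_C(R)` of `C`-injective modules: those isomorphic to `Hom(C, I)` with `I`
injective. -/
def CInjective : ObjectProperty (ModuleCat.{u} R) := fun M =>
  ∃ I : ModuleCat.{u} R, Module.Injective R I ∧ Nonempty (M ≃ₗ[R] (C →ₗ[R] I))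

/-- The class `GF_C(R)` of `G_C`-flat modules. -/
def GCFlat : ObjectProperty (ModuleCat.{u} R) := fun M =>
  ∃ S : ExactSeq R, (∀ i : ℤ, i ≤ 0 → Module.Flat R (S.X i)) ∧
    (∀ i : ℤ, 1 ≤ i → CFlat R C (S.X i)) ∧ S.HasImage M ∧
    ∀ U : ModuleCat.{u} R, CInjective R C U → S.TensorExact U

/-- The natural evaluation map `C ⊗ Hom(C, N) → N`, `c ⊗ f ↦ f c`. -/
noncomputable def evalMap (N : Type u) [AddCommGroup N] [Module R N] :
    TensorProduct R C (C →ₗ[R] N) →ₗ[R] N :=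
  TensorProduct.lift LinearMap.applyₗ

/-- The Bass class `B_C(R)`. -/
def Bass : ObjectProperty (ModuleCat.{u} R) := fun N =>
  (∀ n : ℕ, 1 ≤ n → Subsingleton (Abelian.Ext (ModuleCat.of R C) N n)) ∧
  (∀ n : ℕ, 1 ≤ n → Limits.IsZero
    (((Tor (ModuleCat.{u} R) n).obj (ModuleCat.of R C)).obj (ModuleCat.of R (C →ₗ[R] N)))) ∧
  Function.Bijective (evalMap R C N)

end Semidualizing

/-- One step of the Gorenstein construction on a class `𝒳`: the modules isomorphic to
`im (G₀ ⟶ G⁰)` for an exact sequence `⋯ ⟶ G₁ ⟶ G₀ ⟶ G⁰ ⟶ G¹ ⟶ ⋯` in `𝒳` which stays exact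
under `Hom_R(A, -)` and under `A⁺ ⊗_R -` for all `A` in `𝒳`; here
`A⁺ = Hom_ℤ(A, ℚ/ℤ)` is the character module. -/
def gorStep {R : Type u} [CommRing R] (𝒳 : ObjectProperty (ModuleCat.{u} R)) :
    ObjectProperty (ModuleCat.{u} R) := fun M =>
  ∃ S : ExactSeq R, (∀ i, 𝒳 (S.X i)) ∧ S.HasImage M ∧
    (∀ A : ModuleCat.{u} R, 𝒳 A → S.HomExact A) ∧
    (∀ A : ModuleCat.{u} R, 𝒳 A → S.TensorExact (CharacterModule A))

/-- The classes `Gⁿ(𝒳)`, `n ≥ 1`: `G¹(𝒳) = 𝒳`, and `Gⁿ(𝒳)` is obtained from `Gⁿ⁻¹(𝒳)` by one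
step of the Gorenstein construction for `n ≥ 2`. (The value at `0` is not used.) -/
def gorIter {R : Type u} [CommRing R] (𝒳 : ObjectProperty (ModuleCat.{u} R)) :
    ℕ → ObjectProperty (ModuleCat.{u} R)
  | 0 => 𝒳
  | 1 => 𝒳
  | n + 2 => gorStep (gorIter 𝒳 (n + 1))

end GorFlat

/-! Write 𝒳 for the intersection of the G_C-flat modules and the Bass class. It suffices that one
Gorenstein step does not change 𝒳 (`gorStep_eq`). That 𝒳 is contained in its step is formal: M is an
image in the contractible sequence 0 → M = M → 0.

Conversely let M be an image in a sequence S of modules in 𝒳. Every C ⊗ F with F flat lies in 𝒳.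
Testing S against C ⊗ R ≅ C makes it Hom(C, -)-exact. Testing against C ⊗ F with F free, where (C ⊗
F)⁺ ≅ Hom(C, F⁺), makes it exact under Hom(C, I) ⊗ - for all injective I, because I is a retract of
some F⁺. Hence all images in S lie in the Bass class (`ExactSeq.bass_range`) and have no higher Tor
with Hom(C, I).

By Foxby equivalence (`gcFlat_iff_relGF_hom`), N in the Bass class is G_C-flat iff Hom(C, N) is
Gorenstein flat with Tor vanishing against C as well, for the module and its flat cosyzygies; this
keeps C ⊗ - exact on the coresolution. So Hom(C, M) is coresolved by modules of this relative class,
and a pushout argument (`RelGF.of_coresolving`) puts it into the class, provided the class is closed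
under extensions.

That closure (`RelGF.mid`) is the delicate point. GF-closedness embeds an extension Y into a flat
module with Gorenstein flat cokernel K, but says nothing about Tor(C, K). The missing information is
carried by left injective resolutions of the duals Hom(Y, J) with Ext(C, -)-acyclic syzygies
(`InjRes`): they pass to extensions by a horseshoe, and to Hom(K, J) by Schanuel, at the cost of one
step of length.

Tor vanishing is encoded as vanishing of Ext(A, Hom(B, J)) for injective J, so that dimension
shifting for Ext serves both functors. -/

namespace GorFlat

open TensorProduct

/-! ### Short exact sequences of modules -/

section ShortExactness

variable {R : Type u} [CommRing R] {X Y Z : Type u} [AddCommGroup X] [Module R X]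
  [AddCommGroup Y] [Module R Y] [AddCommGroup Z] [Module R Z]

/-- A map that vanishes on the kernel of a surjection factors through it. -/
theorem exists_desc_of_exact {f : X →ₗ[R] Y} {g : Y →ₗ[R] Z} (hex : Function.Exact f g)
    (hg : Function.Surjective g) {A : Type u} [AddCommGroup A] [Module R A]
    (k : Y →ₗ[R] A) (hk : k ∘ₗ f = 0) : ∃ l : Z →ₗ[R] A, l ∘ₗ g = k := by
  have hker : LinearMap.ker g ≤ LinearMap.ker k := by
    intro y hy
    obtain ⟨x, rfl⟩ := (hex y).1 hy
    exact LinearMap.congr_fun hk x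
  let e := LinearMap.quotKerEquivOfSurjective g hg
  refine ⟨(LinearMap.ker g).liftQ k hker ∘ₗ e.symm.toLinearMap, ?_⟩
  ext y
  have : e.symm (g y) = Submodule.Quotient.mk y := by
    rw [LinearEquiv.symm_apply_eq]; rfl
  simp [this]

/-- `0 ⟶ X ⟶ Y ⟶ Z ⟶ 0` is exact. -/
structure ShortEx (f : X →ₗ[R] Y) (g : Y →ₗ[R] Z) : Prop where
  inj : Function.Injective f
  exact : Function.Exact f g
  surj : Function.Surjective g

namespace ShortEx

variable {f : X →ₗ[R] Y} {g : Y →ₗ[R] Z}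

theorem comp_eq_zero (h : ShortEx f g) : g ∘ₗ f = 0 :=
  LinearMap.ext fun x => (h.exact (f x)).2 ⟨x, rfl⟩

theorem apply_apply (h : ShortEx f g) (x : X) : g (f x) = 0 :=
  (h.exact (f x)).2 ⟨x, rfl⟩

theorem shortExact (h : ShortEx f g) :
    (ShortComplex.mk (ModuleCat.ofHom f) (ModuleCat.ofHom g)
      (by rw [← ModuleCat.ofHom_comp, h.comp_eq_zero]; rfl)).ShortExact where
  exact := (ShortComplex.ShortExact.moduleCat_exact_iff_function_exact _).2 h.exact
  mono_f := (ModuleCat.mono_iff_injective _).2 h.inj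
  epi_g := (ModuleCat.epi_iff_surjective _).2 h.surj

/-- A map into the middle term that dies in the quotient factors through the submodule. -/
theorem exists_lift (h : ShortEx f g) {A : Type u} [AddCommGroup A] [Module R A]
    (k : A →ₗ[R] Y) (hk : g ∘ₗ k = 0) : ∃ l : A →ₗ[R] X, f ∘ₗ l = k := by
  have hr : ∀ a, k a ∈ LinearMap.range f := fun a =>
    (h.exact (k a)).1 (LinearMap.congr_fun hk a)
  refine ⟨(LinearEquiv.ofInjective f h.inj).symm.toLinearMap ∘ₗ k.codRestrict _ hr, ?_⟩
  ext a
  have := LinearEquiv.apply_symm_apply (LinearEquiv.ofInjective f h.inj)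
    (k.codRestrict _ hr a)
  exact congrArg Subtype.val this

theorem exists_desc (h : ShortEx f g) {A : Type u} [AddCommGroup A] [Module R A]
    (k : Y →ₗ[R] A) (hk : k ∘ₗ f = 0) : ∃ l : Z →ₗ[R] A, l ∘ₗ g = k :=
  exists_desc_of_exact h.exact h.surj k hk

theorem range (g : Y →ₗ[R] Z) (h : Function.Exact f g) :
    ShortEx (LinearMap.range f).subtype g.rangeRestrict where
  inj := Subtype.val_injective
  exact y := by
    constructor
    · intro hy
      obtain ⟨x, hx⟩ := (h y).1 (congrArg Subtype.val hy)
      exact ⟨⟨y, x, hx⟩, rfl⟩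
    · rintro ⟨⟨_, x, rfl⟩, rfl⟩
      exact Subtype.ext ((h (f x)).2 ⟨x, rfl⟩)
  surj := g.surjective_rangeRestrict

theorem ker (hg : Function.Surjective g) : ShortEx (LinearMap.ker g).subtype g where
  inj := Subtype.val_injective
  exact y := ⟨fun hy => ⟨⟨y, hy⟩, rfl⟩, by rintro ⟨⟨y, hy⟩, rfl⟩; exact hy⟩
  surj := hg

theorem coker (hf : Function.Injective f) : ShortEx f (LinearMap.range f).mkQ where
  inj := hf
  exact := LinearMap.exact_map_mkQ_range f
  surj := Submodule.mkQ_surjective _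

theorem comp_equiv {X' : Type u} [AddCommGroup X'] [Module R X'] (h : ShortEx f g)
    (e : X' ≃ₗ[R] X) : ShortEx (f ∘ₗ e.toLinearMap) g where
  inj := h.inj.comp e.injective
  exact y := by
    rw [h.exact y]
    exact ⟨fun ⟨x, hx⟩ => ⟨e.symm x, by simpa using hx⟩, fun ⟨x, hx⟩ => ⟨e x, hx⟩⟩
  surj := h.surj

theorem equiv_mid {Y' : Type u} [AddCommGroup Y'] [Module R Y'] (h : ShortEx f g)
    (e : Y ≃ₗ[R] Y') : ShortEx (e.toLinearMap ∘ₗ f) (g ∘ₗ e.symm.toLinearMap) where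
  inj := e.injective.comp h.inj
  exact y := by
    obtain ⟨y, rfl⟩ := e.surjective y
    simpa using h.exact y
  surj := h.surj.comp e.symm.surjective

/-- Homomorphisms from `A` into a short exact sequence. -/
theorem hom (h : ShortEx f g) {A : Type u} [AddCommGroup A] [Module R A]
    (hl : ∀ k : A →ₗ[R] Z, ∃ l : A →ₗ[R] Y, g ∘ₗ l = k) :
    ShortEx (f.compRight R : (A →ₗ[R] X) →ₗ[R] A →ₗ[R] Y) (g.compRight R) where
  inj k l hkl := LinearMap.ext fun a => h.inj (LinearMap.congr_fun hkl a)
  exact k := ⟨fun hk => h.exists_lift k hk, by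
    rintro ⟨l, rfl⟩; exact LinearMap.ext fun a => h.apply_apply _⟩
  surj := hl

/-- Homomorphisms from a short exact sequence into an injective module. -/
theorem dual (h : ShortEx f g) (J : Type u) [AddCommGroup J] [Module R J]
    [hJ : Module.Injective R J] :
    ShortEx (g.lcomp R J) (f.lcomp R J) where
  inj k l hkl := LinearMap.ext fun z => by
    obtain ⟨y, rfl⟩ := h.surj z
    exact LinearMap.congr_fun hkl y
  exact k := ⟨fun hk => h.exists_desc k hk, by
    rintro ⟨l, rfl⟩; exact LinearMap.ext fun a => by simp [h.apply_apply]⟩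
  surj k := by
    obtain ⟨l, hl⟩ := hJ.out f h.inj k
    exact ⟨l, LinearMap.ext hl⟩

theorem lTensor (h : ShortEx f g) {A : Type u} [AddCommGroup A] [Module R A]
    (hi : Function.Injective (f.lTensor A)) : ShortEx (f.lTensor A) (g.lTensor A) where
  inj := hi
  exact := lTensor_exact A h.exact h.surj
  surj := LinearMap.lTensor_surjective A h.surj

end ShortEx

end ShortExactness

/-! ### Vanishing of Ext and dimension shifting -/

section ExtAcyclic

variable {R : Type u} [CommRing R] (A B : Type u) [AddCommGroup A] [Module R A]
  [AddCommGroup B] [Module R B]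

variable (R) in
/-- `Ext^n(A, B) = 0` for all `n ≥ 1`. -/
def ExtAcyclic : Prop :=
  ∀ n : ℕ, 1 ≤ n → Subsingleton (Abelian.Ext (ModuleCat.of R A) (ModuleCat.of R B) n)

theorem ExtAcyclic.of_injective [Module.Injective R B] : ExtAcyclic R A B := by
  intro n hn
  obtain ⟨n, rfl⟩ := Nat.exists_eq_add_of_le' hn
  have := Module.injective_object_of_injective_module R B
  exact Abelian.Ext.subsingleton_of_injective _ _ n

theorem ExtAcyclic.of_projective [Module.Projective R A] : ExtAcyclic R A B := by
  intro n hn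
  obtain ⟨n, rfl⟩ := Nat.exists_eq_add_of_le' hn
  have := (IsProjective.iff_projective (R := R) A).1 inferInstance
  exact Abelian.Ext.subsingleton_of_projective _ _ n

variable {A B} {X Y Z : Type u} [AddCommGroup X] [Module R X]
  [AddCommGroup Y] [Module R Y] [AddCommGroup Z] [Module R Z]
  {f : X →ₗ[R] Y} {g : Y →ₗ[R] Z}

namespace ShortEx

theorem ext_mid (h : ShortEx f g) {n : ℕ}
    (hX : Subsingleton (Abelian.Ext (ModuleCat.of R A) (ModuleCat.of R X) n))
    (hZ : Subsingleton (Abelian.Ext (ModuleCat.of R A) (ModuleCat.of R Z) n)) :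
    Subsingleton (Abelian.Ext (ModuleCat.of R A) (ModuleCat.of R Y) n) := by
  refine subsingleton_of_forall_eq 0 fun x => ?_
  obtain ⟨y, rfl⟩ := Abelian.Ext.covariant_sequence_exact₂ _ h.shortExact x (hZ.elim _ _)
  rw [hX.elim y 0, Abelian.Ext.zero_comp]

theorem ext_right (h : ShortEx f g) {n : ℕ}
    (hY : Subsingleton (Abelian.Ext (ModuleCat.of R A) (ModuleCat.of R Y) n))
    (hX : Subsingleton (Abelian.Ext (ModuleCat.of R A) (ModuleCat.of R X) (n + 1))) :
    Subsingleton (Abelian.Ext (ModuleCat.of R A) (ModuleCat.of R Z) n) := by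
  refine subsingleton_of_forall_eq 0 fun x => ?_
  obtain ⟨y, rfl⟩ := Abelian.Ext.covariant_sequence_exact₃ _ h.shortExact x rfl (hX.elim _ _)
  rw [hY.elim y 0, Abelian.Ext.zero_comp]

theorem ext_left (h : ShortEx f g) {n : ℕ}
    (hZ : Subsingleton (Abelian.Ext (ModuleCat.of R A) (ModuleCat.of R Z) n))
    (hY : Subsingleton (Abelian.Ext (ModuleCat.of R A) (ModuleCat.of R Y) (n + 1))) :
    Subsingleton (Abelian.Ext (ModuleCat.of R A) (ModuleCat.of R X) (n + 1)) := by
  refine subsingleton_of_forall_eq 0 fun x => ?_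
  obtain ⟨y, rfl⟩ := Abelian.Ext.covariant_sequence_exact₁ _ h.shortExact x (hY.elim _ _) rfl
  rw [hZ.elim y 0, Abelian.Ext.zero_comp]

/-- Since Ext¹(A, Y) = 0, every class in Ext¹(A, X) is the connecting image of a map A → Z; such a
map lifts to Y, which kills its image. -/
theorem ext_one_left (h : ShortEx f g)
    (hl : ∀ k : A →ₗ[R] Z, ∃ l : A →ₗ[R] Y, g ∘ₗ l = k)
    (hY : Subsingleton (Abelian.Ext (ModuleCat.of R A) (ModuleCat.of R Y) 1)) :
    Subsingleton (Abelian.Ext (ModuleCat.of R A) (ModuleCat.of R X) 1) := by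
  refine subsingleton_of_forall_eq 0 fun x => ?_
  obtain ⟨y, rfl⟩ := Abelian.Ext.covariant_sequence_exact₁ _ h.shortExact x (hY.elim _ _)
    (zero_add 1)
  obtain ⟨k, rfl⟩ := (Abelian.Ext.mk₀_bijective _ _).2 y
  obtain ⟨l, hl⟩ := hl k.hom
  have : k = ModuleCat.ofHom l ≫ ModuleCat.ofHom g := ModuleCat.hom_ext hl.symm
  rw [this, ← Abelian.Ext.mk₀_comp_mk₀, Abelian.Ext.comp_assoc_of_second_deg_zero]
  erw [h.shortExact.comp_extClass]
  rw [Abelian.Ext.comp_zero]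

theorem lifting (h : ShortEx f g) (hX : ExtAcyclic R A X) (k : A →ₗ[R] Z) :
    ∃ l : A →ₗ[R] Y, g ∘ₗ l = k := by
  obtain ⟨y, hy⟩ := Abelian.Ext.covariant_sequence_exact₃ _ h.shortExact
    (Abelian.Ext.mk₀ (ModuleCat.ofHom k)) (zero_add 1) ((hX 1 le_rfl).elim _ _)
  obtain ⟨l, rfl⟩ := (Abelian.Ext.mk₀_bijective _ _).2 y
  rw [Abelian.Ext.mk₀_comp_mk₀] at hy
  have := (Abelian.Ext.mk₀_bijective _ _).1 hy
  exact ⟨l.hom, congrArg ModuleCat.Hom.hom this⟩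

theorem extAcyclic_mid (h : ShortEx f g) (hX : ExtAcyclic R A X) (hZ : ExtAcyclic R A Z) :
    ExtAcyclic R A Y := fun n hn => h.ext_mid (hX n hn) (hZ n hn)

theorem extAcyclic_right (h : ShortEx f g) (hX : ExtAcyclic R A X) (hY : ExtAcyclic R A Y) :
    ExtAcyclic R A Z := fun n hn => h.ext_right (hY n hn) (hX (n + 1) (by lia))

/-- Dimension shifting in the first variable. -/
theorem ext_one_of_extend (h : ShortEx f g) (hl : ∀ k : X →ₗ[R] B, ∃ l : Y →ₗ[R] B, l ∘ₗ f = k)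
    (hY : Subsingleton (Abelian.Ext (ModuleCat.of R Y) (ModuleCat.of R B) 1)) :
    Subsingleton (Abelian.Ext (ModuleCat.of R Z) (ModuleCat.of R B) 1) := by
  refine subsingleton_of_forall_eq 0 fun x => ?_
  obtain ⟨y, rfl⟩ := Abelian.Ext.contravariant_sequence_exact₃ h.shortExact _ x (hY.elim _ _)
    (add_zero 1)
  obtain ⟨k, rfl⟩ := (Abelian.Ext.mk₀_bijective _ _).2 y
  obtain ⟨l, hl⟩ := hl k.hom
  have : k = ModuleCat.ofHom f ≫ ModuleCat.ofHom l := ModuleCat.hom_ext hl.symm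
  rw [this, ← Abelian.Ext.mk₀_comp_mk₀, ← Abelian.Ext.comp_assoc_of_second_deg_zero]
  erw [h.shortExact.extClass_comp]
  rw [Abelian.Ext.zero_comp]

theorem ext_succ_of_ext (h : ShortEx f g) {n : ℕ}
    (hX : Subsingleton (Abelian.Ext (ModuleCat.of R X) (ModuleCat.of R B) n))
    (hY : Subsingleton (Abelian.Ext (ModuleCat.of R Y) (ModuleCat.of R B) (n + 1))) :
    Subsingleton (Abelian.Ext (ModuleCat.of R Z) (ModuleCat.of R B) (n + 1)) := by
  refine subsingleton_of_forall_eq 0 fun x => ?_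
  obtain ⟨y, rfl⟩ := Abelian.Ext.contravariant_sequence_exact₃ h.shortExact _ x (hY.elim _ _)
    (add_comm 1 n)
  rw [hX.elim y 0, Abelian.Ext.comp_zero]

theorem extend (h : ShortEx f g) (hZ : ExtAcyclic R Z B) (k : X →ₗ[R] B) :
    ∃ l : Y →ₗ[R] B, l ∘ₗ f = k := by
  obtain ⟨y, hy⟩ := Abelian.Ext.contravariant_sequence_exact₁ h.shortExact _
    (Abelian.Ext.mk₀ (ModuleCat.ofHom k)) (add_zero 1) ((hZ 1 le_rfl).elim _ _)
  obtain ⟨l, rfl⟩ := (Abelian.Ext.mk₀_bijective _ _).2 y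
  rw [Abelian.Ext.mk₀_comp_mk₀] at hy
  have := (Abelian.Ext.mk₀_bijective _ _).1 hy
  exact ⟨l.hom, congrArg ModuleCat.Hom.hom this⟩

theorem extAcyclic_source_left (h : ShortEx f g) (hY : ExtAcyclic R Y B)
    (hZ : ExtAcyclic R Z B) : ExtAcyclic R X B := by
  intro n hn
  refine subsingleton_of_forall_eq 0 fun x => ?_
  obtain ⟨y, rfl⟩ := Abelian.Ext.contravariant_sequence_exact₁ h.shortExact _ x rfl
    ((hZ (1 + n) (by lia)).elim _ _)
  rw [(hY n hn).elim y 0, Abelian.Ext.comp_zero]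

end ShortEx

/-- An isomorphism is a short exact sequence with zero kernel, so the long exact sequence applies.
-/
theorem ExtAcyclic.congr_right (h : ExtAcyclic R A X) (e : X ≃ₗ[R] Y) : ExtAcyclic R A Y := by
  have h0 : Function.Injective (0 : PUnit.{u + 1} →ₗ[R] X) := fun _ _ _ => rfl
  have hs : ShortEx (0 : PUnit.{u + 1} →ₗ[R] X) e.toLinearMap :=
    ⟨h0, fun x => by simp [eq_comm (a := (0 : X))], e.surjective⟩
  have : Module.Injective R PUnit.{u + 1} := ⟨fun _ _ _ _ _ _ _ _ _ => ⟨0, fun _ => rfl⟩⟩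
  exact hs.extAcyclic_right (.of_injective _ _) h

theorem ExtAcyclic.congr_left (h : ExtAcyclic R X B) (e : X ≃ₗ[R] Y) : ExtAcyclic R Y B := by
  have hs : ShortEx e.symm.toLinearMap (0 : X →ₗ[R] PUnit.{u + 1}) :=
    ⟨e.symm.injective, fun x => by simp, fun _ => ⟨0, rfl⟩⟩
  exact hs.extAcyclic_source_left h (.of_projective _ _)

/-- A class of modules such that each member embeds into an `Ext(A, -)`-acyclic module, with
quotient in the class and with lifting of homomorphisms out of `A`, is `Ext(A, -)`-acyclic. -/
theorem ExtAcyclic.of_coresolving (P : ModuleCat.{u} R → Prop)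
    (h : ∀ Z, P Z → ∃ (S Z' : ModuleCat.{u} R) (f : Z →ₗ[R] S) (g : S →ₗ[R] Z'), ShortEx f g ∧
      ExtAcyclic R A S ∧ (∀ k : A →ₗ[R] Z', ∃ l : A →ₗ[R] S, g ∘ₗ l = k) ∧ P Z') :
    ∀ Z, P Z → ExtAcyclic R A Z := by
  suffices H : ∀ n : ℕ, ∀ Z, P Z →
      Subsingleton (Abelian.Ext (ModuleCat.of R A) (ModuleCat.of R Z) (n + 1)) by
    intro Z hZ n hn
    obtain ⟨n, rfl⟩ := Nat.exists_eq_add_of_le' hn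
    exact H n Z hZ
  intro n
  induction n with
  | zero =>
    intro Z hZ
    obtain ⟨S, Z', f, g, hs, hS, hl, -⟩ := h Z hZ
    exact hs.ext_one_left hl (hS 1 le_rfl)
  | succ n ih =>
    intro Z hZ
    obtain ⟨S, Z', f, g, hs, hS, -, hZ'⟩ := h Z hZ
    exact hs.ext_left (ih Z' hZ') (hS _ (by lia))

/-- A class of modules such that each member is a quotient of an `Ext(-, B)`-acyclic module, with
kernel in the class and with extension of homomorphisms into `B`, is `Ext(-, B)`-acyclic. -/
theorem ExtAcyclic.of_resolving (P : ModuleCat.{u} R → Prop)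
    (h : ∀ Z, P Z → ∃ (S Z' : ModuleCat.{u} R) (f : Z' →ₗ[R] S) (g : S →ₗ[R] Z), ShortEx f g ∧
      ExtAcyclic R S B ∧ (∀ k : Z' →ₗ[R] B, ∃ l : S →ₗ[R] B, l ∘ₗ f = k) ∧ P Z') :
    ∀ Z, P Z → ExtAcyclic R Z B := by
  suffices H : ∀ n : ℕ, ∀ Z, P Z →
      Subsingleton (Abelian.Ext (ModuleCat.of R Z) (ModuleCat.of R B) (n + 1)) by
    intro Z hZ n hn
    obtain ⟨n, rfl⟩ := Nat.exists_eq_add_of_le' hn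
    exact H n Z hZ
  intro n
  induction n with
  | zero =>
    intro Z hZ
    obtain ⟨S, Z', f, g, hs, hS, hl, -⟩ := h Z hZ
    exact hs.ext_one_of_extend hl (hS 1 le_rfl)
  | succ n ih =>
    intro Z hZ
    obtain ⟨S, Z', f, g, hs, hS, -, hZ'⟩ := h Z hZ
    exact hs.ext_succ_of_ext (ih Z' hZ') (hS _ (by lia))

end ExtAcyclic

/-! ### Vanishing of Tor through injective duals -/

section TorAcyclic

variable {R : Type u} [CommRing R]

theorem exists_injective_embedding (M : Type u) [AddCommGroup M] [Module R M] :
    ∃ (J : ModuleCat.{u} R) (f : M →ₗ[R] J), Module.Injective R J ∧ Function.Injective f := by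
  obtain ⟨J⟩ := EnoughInjectives.presentation (ModuleCat.of R M)
  exact ⟨J.J, J.f.hom, (Module.injective_iff_injective_object R J.J).2 J.injective,
    (ModuleCat.mono_iff_injective _).1 J.mono⟩

theorem exists_free_presentation (M : Type u) [AddCommGroup M] [Module R M] :
    ∃ (K P : ModuleCat.{u} R) (f : K →ₗ[R] P) (g : P →ₗ[R] M), ShortEx f g ∧
      Module.Free R P := by
  let g := Finsupp.linearCombination R (id : M → M)
  exact ⟨ModuleCat.of R (LinearMap.ker g), ModuleCat.of R (M →₀ R), _, g,
    .ker (Finsupp.linearCombination_id_surjective R M), inferInstanceAs (Module.Free R (M →₀ R))⟩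

/-- An embedding of X into an injective module extends over f, so f is injective. This converts
lifting statements about duals into injectivity of tensored maps. -/
theorem injective_of_forall_extend {X Y : Type u} [AddCommGroup X] [Module R X]
    [AddCommGroup Y] [Module R Y] (f : X →ₗ[R] Y)
    (h : ∀ (J : Type u) [AddCommGroup J] [Module R J] [Module.Injective R J] (k : X →ₗ[R] J),
      ∃ l : Y →ₗ[R] J, l ∘ₗ f = k) : Function.Injective f := by
  obtain ⟨J, k, hJ, hk⟩ := exists_injective_embedding (R := R) X
  obtain ⟨l, rfl⟩ := h J k
  exact Function.Injective.of_comp hk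

/-- By adjunction, extending X → Hom(F, J) along f amounts to extending X ⊗ F → J along f ⊗ F, which
is injective by flatness. -/
instance injective_hom_of_flat (F J : Type u) [AddCommGroup F] [Module R F] [AddCommGroup J]
    [Module R J] [Module.Flat R F] [hJ : Module.Injective R J] :
    Module.Injective R (F →ₗ[R] J) where
  out X Y _ _ _ _ f hf g := by
    obtain ⟨h, hh⟩ := hJ.out (f.rTensor F)
      (Module.Flat.rTensor_preserves_injective_linearMap f hf) (TensorProduct.lift g)
    refine ⟨TensorProduct.curry h, fun x => LinearMap.ext fun y => ?_⟩
    simpa using hh (x ⊗ₜ y)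

variable (A B : Type u) [AddCommGroup A] [Module R A] [AddCommGroup B] [Module R B]

variable (R) in
/-- `Tor_n(A, B) = 0` for all `n ≥ 1`, expressed through the duality
`Ext^n(A, Hom(B, J)) ≅ Hom(Tor_n(A, B), J)` for injective `J`. -/
def TorAcyclic : Prop :=
  ∀ (J : Type u) [AddCommGroup J] [Module R J] [Module.Injective R J],
    ExtAcyclic R A (B →ₗ[R] J)

theorem TorAcyclic.of_flat [Module.Flat R B] : TorAcyclic R A B :=
  fun _ _ _ _ => .of_injective _ _

variable {A B} {X Y Z : Type u} [AddCommGroup X] [Module R X]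
  [AddCommGroup Y] [Module R Y] [AddCommGroup Z] [Module R Z]
  {f : X →ₗ[R] Y} {g : Y →ₗ[R] Z}

/-- Lifting along `Hom(Y, J) → Hom(X, J)` is extension along `A ⊗ X → A ⊗ Y`. -/
theorem lcomp_lifting_iff {J : Type u} [AddCommGroup J] [Module R J] :
    (∀ k : A →ₗ[R] X →ₗ[R] J, ∃ l : A →ₗ[R] Y →ₗ[R] J, f.lcomp R J ∘ₗ l = k) ↔
      ∀ k : A ⊗[R] X →ₗ[R] J, ∃ l : A ⊗[R] Y →ₗ[R] J, l ∘ₗ f.lTensor A = k := by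
  constructor
  · intro h k
    obtain ⟨l, hl⟩ := h (TensorProduct.curry k)
    refine ⟨TensorProduct.lift l, TensorProduct.ext' fun a x => ?_⟩
    simpa using LinearMap.congr_fun (LinearMap.congr_fun hl a) x
  · intro h k
    obtain ⟨l, hl⟩ := h (TensorProduct.lift k)
    refine ⟨TensorProduct.curry l, LinearMap.ext fun a => LinearMap.ext fun x => ?_⟩
    simpa using LinearMap.congr_fun hl (a ⊗ₜ x)

theorem lcomp_lifting {J : Type u} [AddCommGroup J] [Module R J] [hJ : Module.Injective R J]
    (hi : Function.Injective (f.lTensor A)) (k : A →ₗ[R] X →ₗ[R] J) :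
    ∃ l : A →ₗ[R] Y →ₗ[R] J, f.lcomp R J ∘ₗ l = k :=
  lcomp_lifting_iff.2 (fun k => let ⟨l, hl⟩ := hJ.out _ hi k; ⟨l, LinearMap.ext hl⟩) k

theorem TorAcyclic.congr_right (h : TorAcyclic R A X) (e : X ≃ₗ[R] Y) : TorAcyclic R A Y :=
  fun J _ _ _ => (h J).congr_right (e.congrLeft J R)

theorem TorAcyclic.congr_left (h : TorAcyclic R X B) (e : X ≃ₗ[R] Y) : TorAcyclic R Y B :=
  fun J _ _ _ => (h J).congr_left e

namespace ShortEx

theorem lTensor_injective (h : ShortEx f g) (hZ : TorAcyclic R A Z) :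
    Function.Injective (f.lTensor A) :=
  injective_of_forall_extend _ fun J _ _ _ =>
    lcomp_lifting_iff.1 ((h.dual J).lifting (hZ J))

theorem torAcyclic_left (h : ShortEx f g) (hY : TorAcyclic R A Y) (hZ : TorAcyclic R A Z) :
    TorAcyclic R A X := fun J _ _ _ => (h.dual J).extAcyclic_right (hZ J) (hY J)

end ShortEx

/-- A class of modules such that each member is a quotient of a `Tor(A, -)`-acyclic module, with
kernel in the class which stays a submodule after tensoring with `A`, is `Tor(A, -)`-acyclic. -/
theorem TorAcyclic.of_resolving (P : ModuleCat.{u} R → Prop)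
    (h : ∀ Z, P Z → ∃ (S Z' : ModuleCat.{u} R) (f : Z' →ₗ[R] S) (g : S →ₗ[R] Z), ShortEx f g ∧
      TorAcyclic R A S ∧ Function.Injective (f.lTensor A) ∧ P Z') :
    ∀ Z, P Z → TorAcyclic R A Z := by
  intro Z hZ J _ _ _
  refine ExtAcyclic.of_coresolving
    (fun W => ∃ Z : ModuleCat.{u} R, P Z ∧ W = ModuleCat.of R (Z →ₗ[R] J)) ?_ _ ⟨Z, hZ, rfl⟩
  rintro _ ⟨Z, hZ, rfl⟩
  obtain ⟨S, Z', f, g, hs, hS, hi, hZ'⟩ := h Z hZ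
  exact ⟨ModuleCat.of R (S →ₗ[R] J), ModuleCat.of R (Z' →ₗ[R] J), _, _, hs.dual J, hS J,
    fun k => lcomp_lifting hi k, Z', hZ', rfl⟩

theorem ShortEx.torAcyclic_right (h : ShortEx f g) (hX : TorAcyclic R A X)
    (hY : TorAcyclic R A Y) (hi : Function.Injective (f.lTensor A)) : TorAcyclic R A Z := by
  intro J _ _ _ n hn
  obtain ⟨n, rfl⟩ := Nat.exists_eq_add_of_le' hn
  cases n with
  | zero => exact (h.dual J).ext_one_left (fun k => lcomp_lifting hi k) (hY J 1 le_rfl)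
  | succ n => exact (h.dual J).ext_left (hX J _ (by lia)) (hY J _ (by lia))

/-- Balancing of Tor: dualizing a free presentation K → P → A coresolves Hom(A, J) by the injective
Hom(P, J), and lifting B → Hom(K, J) is, after swapping arguments, extending K → Hom(B, J) to P. -/
theorem ExtAcyclic.flip_hom {J : Type u} [AddCommGroup J] [Module R J] [Module.Injective R J]
    (h : ExtAcyclic R A (B →ₗ[R] J)) : ExtAcyclic R B (A →ₗ[R] J) := by
  refine ExtAcyclic.of_coresolving (fun W => ∃ A : ModuleCat.{u} R,
    ExtAcyclic R A (B →ₗ[R] J) ∧ W = ModuleCat.of R (A →ₗ[R] J)) ?_ _ ⟨ModuleCat.of R A, h, rfl⟩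
  rintro _ ⟨A, hA, rfl⟩
  obtain ⟨K, P, f, g, hs, hP⟩ := exists_free_presentation (R := R) A
  refine ⟨ModuleCat.of R (P →ₗ[R] J), ModuleCat.of R (K →ₗ[R] J), _, _, hs.dual J,
    .of_injective _ _, fun k => ?_, K, hs.extAcyclic_source_left (.of_projective _ _) hA, rfl⟩
  obtain ⟨l, hl⟩ := hs.extend hA (LinearMap.flip k)
  exact ⟨LinearMap.flip l, LinearMap.ext fun b => LinearMap.ext fun x =>
    LinearMap.congr_fun (LinearMap.congr_fun hl x) b⟩

theorem TorAcyclic.symm (h : TorAcyclic R A B) : TorAcyclic R B A :=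
  fun J _ _ _ => (h J).flip_hom

end TorAcyclic

/-! ### Pushout, horseshoe and Schanuel diagrams -/

section Diagrams

variable {R : Type u} [CommRing R] {X Y Z W V : Type u} [AddCommGroup X] [Module R X]
  [AddCommGroup Y] [Module R Y] [AddCommGroup Z] [Module R Z] [AddCommGroup W] [Module R W]
  [AddCommGroup V] [Module R V]

namespace ShortEx

/-- The cokernel of a composite of monomorphisms is an extension of the two cokernels. -/
theorem exists_comp {f : X →ₗ[R] Y} {g : Y →ₗ[R] Z} {f' : Y →ₗ[R] W} {g' : W →ₗ[R] V}
    (h : ShortEx f g) (h' : ShortEx f' g') :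
    ∃ (Q : ModuleCat.{u} R) (p : W →ₗ[R] Q) (a : Z →ₗ[R] Q) (b : Q →ₗ[R] V),
      ShortEx (f' ∘ₗ f) p ∧ ShortEx a b := by
  have hc : ShortEx (f' ∘ₗ f) (LinearMap.range (f' ∘ₗ f)).mkQ := .coker (h'.inj.comp h.inj)
  obtain ⟨b, hb⟩ := hc.exists_desc g' (by
    rw [← LinearMap.comp_assoc, h'.comp_eq_zero, LinearMap.zero_comp])
  obtain ⟨a, ha⟩ := h.exists_desc ((LinearMap.range (f' ∘ₗ f)).mkQ ∘ₗ f') (by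
    rw [LinearMap.comp_assoc, hc.comp_eq_zero])
  have ha' := LinearMap.congr_fun ha
  have hb' := LinearMap.congr_fun hb
  simp only [LinearMap.comp_apply] at ha' hb'
  refine ⟨ModuleCat.of R (W ⧸ LinearMap.range (f' ∘ₗ f)), _, a, b, hc, ?_, ?_, ?_⟩
  · rw [injective_iff_map_eq_zero]
    intro z hz
    obtain ⟨y, rfl⟩ := h.surj z
    rw [ha'] at hz
    obtain ⟨x, hx⟩ := (hc.exact _).1 hz
    rw [← h'.inj hx, h.apply_apply]
  · intro q
    obtain ⟨w, rfl⟩ := hc.surj q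
    rw [hb', h'.exact w]
    constructor
    · rintro ⟨y, rfl⟩
      exact ⟨g y, ha' y⟩
    · rintro ⟨z, hz⟩
      obtain ⟨y, rfl⟩ := h.surj z
      rw [ha', ← sub_eq_zero, ← map_sub] at hz
      obtain ⟨x, hx⟩ := (hc.exact _).1 hz
      exact ⟨y - f x, by rw [map_sub, show f' (f x) = f' y - w from hx, sub_sub_cancel]⟩
  · intro v
    obtain ⟨w, rfl⟩ := h'.surj v
    exact ⟨_, hb' w⟩

/-- Pushout of two short exact sequences with the same left term. -/
theorem exists_pushout {j : X →ₗ[R] Y} {q : Y →ₗ[R] Z} {i : X →ₗ[R] W} {p : W →ₗ[R] V}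
    (h : ShortEx j q) (h' : ShortEx i p) :
    ∃ (H : ModuleCat.{u} R) (a : W →ₗ[R] H) (b : H →ₗ[R] Z) (c : Y →ₗ[R] H) (d : H →ₗ[R] V),
      ShortEx a b ∧ ShortEx c d := by
  let k : X →ₗ[R] Y × W := j.prod (-i)
  have hk : ShortEx k (LinearMap.range k).mkQ :=
    .coker fun x x' hx => h.inj (congrArg Prod.fst hx)
  obtain ⟨b, hb⟩ := hk.exists_desc (q ∘ₗ LinearMap.fst R Y W)
    (LinearMap.ext fun x => h.apply_apply x)
  obtain ⟨d, hd⟩ := hk.exists_desc (p ∘ₗ LinearMap.snd R Y W)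
    (LinearMap.ext fun x => by simp [k, h'.apply_apply])
  have hb' : ∀ y w, b (Submodule.Quotient.mk (y, w)) = q y := fun y w =>
    LinearMap.congr_fun hb (y, w)
  have hd' : ∀ y w, d (Submodule.Quotient.mk (y, w)) = p w := fun y w =>
    LinearMap.congr_fun hd (y, w)
  have h0 : ∀ (y : Y) (w : W),
      (Submodule.Quotient.mk (y, w) : (Y × W) ⧸ LinearMap.range k) = 0 ↔
      ∃ x, j x = y ∧ -i x = w := by
    intro y w
    rw [Submodule.Quotient.mk_eq_zero]
    simp [k]
  refine ⟨ModuleCat.of R ((Y × W) ⧸ LinearMap.range k),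
    (LinearMap.range k).mkQ ∘ₗ LinearMap.inr R Y W, b,
    (LinearMap.range k).mkQ ∘ₗ LinearMap.inl R Y W, d, ⟨?_, ?_, ?_⟩, ⟨?_, ?_, ?_⟩⟩
  · rw [injective_iff_map_eq_zero]
    intro w hw
    obtain ⟨x, hx, rfl⟩ := (h0 0 w).1 hw
    rw [h.inj (hx.trans j.map_zero.symm), map_zero, neg_zero]
  · intro t
    obtain ⟨⟨y, w⟩, rfl⟩ := Submodule.Quotient.mk_surjective _ t
    rw [hb', h.exact y]
    constructor
    · rintro ⟨x, rfl⟩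
      refine ⟨w + i x, ?_⟩
      rw [← sub_eq_zero]
      exact (h0 _ _).2 ⟨-x, by simp⟩
    · rintro ⟨w', hw'⟩
      rw [eq_comm, ← sub_eq_zero] at hw'
      obtain ⟨x, hx, -⟩ := (h0 (y - 0) (w - w')).1 hw'
      exact ⟨x, by simpa using hx⟩
  · intro z
    obtain ⟨y, rfl⟩ := h.surj z
    exact ⟨_, hb' y 0⟩
  · rw [injective_iff_map_eq_zero]
    intro y hy
    obtain ⟨x, rfl, hx⟩ := (h0 y 0).1 hy
    rw [h'.inj ((neg_eq_zero.1 hx).trans i.map_zero.symm), map_zero]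
  · intro t
    obtain ⟨⟨y, w⟩, rfl⟩ := Submodule.Quotient.mk_surjective _ t
    rw [hd', h'.exact w]
    constructor
    · rintro ⟨x, rfl⟩
      refine ⟨y + j x, ?_⟩
      rw [← sub_eq_zero]
      exact (h0 _ _).2 ⟨x, by simp⟩
    · rintro ⟨y', hy'⟩
      rw [eq_comm, ← sub_eq_zero] at hy'
      obtain ⟨x, -, hx⟩ := (h0 (y - y') (w - 0)).1 hy'
      exact ⟨-x, by simpa using hx⟩
  · intro v
    obtain ⟨w, rfl⟩ := h'.surj v
    exact ⟨_, hd' 0 w⟩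

/-- The kernel of a composite of epimorphisms is an extension of the two kernels. -/
theorem exists_comp_ker {f : X →ₗ[R] Y} {g : Y →ₗ[R] Z} {f' : W →ₗ[R] V} {g' : V →ₗ[R] Y}
    (h : ShortEx f g) (h' : ShortEx f' g') :
    ∃ (K : ModuleCat.{u} R) (i : K →ₗ[R] V) (a : W →ₗ[R] K) (b : K →ₗ[R] X),
      ShortEx i (g ∘ₗ g') ∧ ShortEx a b := by
  have hK : ShortEx (LinearMap.ker (g ∘ₗ g')).subtype (g ∘ₗ g') := .ker (h.surj.comp h'.surj)
  obtain ⟨a, ha⟩ := hK.exists_lift f' (by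
    rw [LinearMap.comp_assoc, h'.comp_eq_zero, LinearMap.comp_zero])
  obtain ⟨b, hb⟩ := h.exists_lift (g' ∘ₗ (LinearMap.ker (g ∘ₗ g')).subtype) (by
    rw [← LinearMap.comp_assoc, hK.comp_eq_zero])
  have ha' := LinearMap.congr_fun ha
  have hb' := LinearMap.congr_fun hb
  simp only [LinearMap.comp_apply] at ha' hb'
  refine ⟨ModuleCat.of R (LinearMap.ker (g ∘ₗ g')), _, a, b, hK, ?_, ?_, ?_⟩
  · intro w w' hw
    exact h'.inj (by rw [← ha', ← ha', hw])
  · intro v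
    rw [← map_eq_zero_iff f h.inj, hb', h'.exact]
    constructor
    · rintro ⟨w, hw⟩
      exact ⟨w, Subtype.ext ((ha' w).trans hw)⟩
    · rintro ⟨w, rfl⟩
      exact ⟨w, (ha' w).symm⟩
  · intro x
    obtain ⟨v, hv⟩ := h'.surj (f x)
    refine ⟨⟨v, ?_⟩, h.inj ?_⟩
    · simp [hv, h.apply_apply]
    · rw [hb']; exact hv

/-- Horseshoe: resolve the outer terms of a short exact sequence, given a lift of the
resolution of the quotient. -/
theorem exists_horseshoe {a : X →ₗ[R] Y} {b : Y →ₗ[R] Z} (h : ShortEx a b)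
    {K₂ E₂ K₁ E₁ : Type u} [AddCommGroup K₂] [Module R K₂] [AddCommGroup E₂] [Module R E₂]
    [AddCommGroup K₁] [Module R K₁] [AddCommGroup E₁] [Module R E₁]
    {i₂ : K₂ →ₗ[R] E₂} {p₂ : E₂ →ₗ[R] X} (h₂ : ShortEx i₂ p₂)
    {i₁ : K₁ →ₗ[R] E₁} {p₁ : E₁ →ₗ[R] Z} (h₁ : ShortEx i₁ p₁)
    (q : E₁ →ₗ[R] Y) (hq : b ∘ₗ q = p₁) :
    ∃ (K : ModuleCat.{u} R) (i : K →ₗ[R] E₂ × E₁) (p : E₂ × E₁ →ₗ[R] Y) (c : K₂ →ₗ[R] K)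
      (d : K →ₗ[R] K₁), ShortEx i p ∧ ShortEx c d := by
  let p : E₂ × E₁ →ₗ[R] Y := (a ∘ₗ p₂).coprod q
  have hq' := LinearMap.congr_fun hq
  simp only [LinearMap.comp_apply] at hq'
  have hp : Function.Surjective p := by
    intro y
    obtain ⟨e, he⟩ := h₁.surj (b y)
    obtain ⟨x, hx⟩ := (h.exact (y - q e)).1 (by rw [map_sub, hq', he, sub_self])
    obtain ⟨e', rfl⟩ := h₂.surj x
    exact ⟨(e', e), by simp [p, hx]⟩
  have hK := ShortEx.ker hp
  obtain ⟨c, hc⟩ := hK.exists_lift (LinearMap.inl R E₂ E₁ ∘ₗ i₂)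
    (LinearMap.ext fun k => by simp [p, h₂.apply_apply])
  obtain ⟨d, hd⟩ := h₁.exists_lift (LinearMap.snd R E₂ E₁ ∘ₗ (LinearMap.ker p).subtype) (by
    ext ⟨⟨x, y⟩, hxy⟩
    have : b (p (x, y)) = 0 := by rw [LinearMap.mem_ker.1 hxy, map_zero]
    simpa [p, h.apply_apply, hq'] using this)
  have hc' : ∀ k, (c k : E₂ × E₁) = (i₂ k, 0) := LinearMap.congr_fun hc
  have hd' : ∀ k : LinearMap.ker p, i₁ (d k) = (k : E₂ × E₁).2 := LinearMap.congr_fun hd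
  refine ⟨ModuleCat.of R (LinearMap.ker p), _, p, c, d, hK, ?_, ?_, ?_⟩
  · intro k k' hk
    have := congrArg (fun t : LinearMap.ker p => (t : E₂ × E₁).1) hk
    simp only [hc'] at this
    exact h₂.inj this
  · rintro ⟨⟨x, y⟩, hxy⟩
    rw [← map_eq_zero_iff i₁ h₁.inj, hd']
    constructor
    · rintro (rfl : y = 0)
      have : a (p₂ x) = 0 := by simpa [p] using hxy
      obtain ⟨k, rfl⟩ := (h₂.exact x).1 (h.inj (this.trans a.map_zero.symm))
      exact ⟨k, Subtype.ext (hc' k)⟩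
    · rintro ⟨k, hk⟩
      have := congrArg (fun t : LinearMap.ker p => (t : E₂ × E₁).2) hk
      simp only [hc'] at this
      exact this.symm
  · intro k
    obtain ⟨x, hx⟩ := (h.exact (q (i₁ k))).1 (by rw [hq', h₁.apply_apply])
    obtain ⟨e, rfl⟩ := h₂.surj x
    refine ⟨⟨(-e, i₁ k), ?_⟩, h₁.inj (hd' _)⟩
    simp [p, hx]

/-- Schanuel: two epimorphisms onto `Y` with a lift of the first one through the second. -/
theorem exists_schanuel {Y₁ E Y' E' : Type u} [AddCommGroup Y₁] [Module R Y₁] [AddCommGroup E]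
    [Module R E] [AddCommGroup Y'] [Module R Y'] [AddCommGroup E'] [Module R E']
    {i : Y₁ →ₗ[R] E} {p : E →ₗ[R] Y} {i' : Y' →ₗ[R] E'} {p' : E' →ₗ[R] Y}
    (h : ShortEx i p) (h' : ShortEx i' p') (s : E →ₗ[R] E') (hs : p' ∘ₗ s = p) :
    ∃ (P : ModuleCat.{u} R) (a : Y₁ →ₗ[R] P) (b : P →ₗ[R] E') (c : E →ₗ[R] P)
      (d : P →ₗ[R] Y'), ShortEx a b ∧ ShortEx c d := by
  let φ : E × E' →ₗ[R] Y := p.coprod (-p')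
  have hs' := LinearMap.congr_fun hs
  simp only [LinearMap.comp_apply] at hs'
  have hφ : ∀ x y, φ (x, y) = 0 ↔ p x = p' y := by
    intro x y; simp [φ, ← sub_eq_add_neg, sub_eq_zero]
  have hK := ShortEx.ker (g := φ) (fun y => by
    obtain ⟨x, rfl⟩ := h.surj y; exact ⟨(x, 0), by simp [φ]⟩)
  obtain ⟨a, ha⟩ := hK.exists_lift (LinearMap.inl R E E' ∘ₗ i)
    (LinearMap.ext fun k => by simp [φ, h.apply_apply])
  obtain ⟨c, hc⟩ := hK.exists_lift (LinearMap.id.prod s)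
    (LinearMap.ext fun k => by simp [φ, hs'])
  -- The kernel of `φ` is the pullback of `p` and `p'`. The lift `s` splits its projection to `E`,
  -- and `d` is the complementary projection onto `Y'`.
  obtain ⟨d, hd⟩ := h'.exists_lift
    ((LinearMap.snd R E E' - s ∘ₗ LinearMap.fst R E E') ∘ₗ (LinearMap.ker φ).subtype) (by
      ext ⟨⟨x, y⟩, hxy⟩
      simp [hs', (hφ x y).1 hxy])
  have ha' : ∀ k, (a k : E × E') = (i k, 0) := LinearMap.congr_fun ha
  have hc' : ∀ k, (c k : E × E') = (k, s k) := LinearMap.congr_fun hc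
  have hd' : ∀ k : LinearMap.ker φ, i' (d k) = (k : E × E').2 - s (k : E × E').1 :=
    LinearMap.congr_fun hd
  refine ⟨ModuleCat.of R (LinearMap.ker φ), a,
    LinearMap.snd R E E' ∘ₗ (LinearMap.ker φ).subtype, c, d, ⟨?_, ?_, ?_⟩, ⟨?_, ?_, ?_⟩⟩
  · intro k k' hk
    have := congrArg (fun t : LinearMap.ker φ => (t : E × E').1) hk
    simp only [ha'] at this
    exact h.inj this
  · rintro ⟨⟨x, y⟩, hxy⟩
    constructor
    · rintro (rfl : y = 0)
      obtain ⟨k, rfl⟩ := (h.exact x).1 (by simpa using (hφ x 0).1 hxy)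
      exact ⟨k, Subtype.ext (ha' k)⟩
    · rintro ⟨k, hk⟩
      have := congrArg (fun t : LinearMap.ker φ => (t : E × E').2) hk
      simp only [ha'] at this
      exact this.symm
  · intro y
    obtain ⟨x, hx⟩ := h.surj (p' y)
    exact ⟨⟨(x, y), (hφ x y).2 hx⟩, rfl⟩
  · intro k k' hk
    have := congrArg (fun t : LinearMap.ker φ => (t : E × E').1) hk
    simpa only [hc'] using this
  · rintro ⟨⟨x, y⟩, hxy⟩
    rw [← map_eq_zero_iff i' h'.inj, hd', sub_eq_zero]
    constructor
    · rintro (rfl : y = s x)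
      exact ⟨x, Subtype.ext (hc' x)⟩
    · rintro ⟨k, hk⟩
      have := congrArg (fun t : LinearMap.ker φ => (t : E × E')) hk
      simp only [hc', Prod.mk.injEq] at this
      exact this.2.symm.trans (congrArg s this.1)
  · intro y'
    refine ⟨⟨(0, i' y'), (hφ _ _).2 (by simp [h'.apply_apply])⟩, h'.inj ?_⟩
    rw [hd']; simp

end ShortEx

end Diagrams

/-! ### Relative Gorenstein flat modules: extensions and stability -/

section RelativeGorenstein

variable {R : Type u} [CommRing R]

/-- The largest class of modules that are `Tor`-acyclic with respect to the test class `𝒰` and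
embed into a module of `ℱ` with quotient again in the class. -/
def RelGF (𝒰 ℱ : ModuleCat.{u} R → Prop) (N : ModuleCat.{u} R) : Prop :=
  ∃ P : ModuleCat.{u} R → Prop, P N ∧ ∀ A, P A → (∀ U, 𝒰 U → TorAcyclic R U A) ∧
    ∃ (F K : ModuleCat.{u} R) (f : A →ₗ[R] F) (g : F →ₗ[R] K), ShortEx f g ∧ ℱ F ∧ P K

variable {𝒰 𝒱 ℱ : ModuleCat.{u} R → Prop}

theorem RelGF.torAcyclic {N : ModuleCat.{u} R} (h : RelGF 𝒰 ℱ N) {U : ModuleCat.{u} R}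
    (hU : 𝒰 U) : TorAcyclic R U N := by
  obtain ⟨P, hN, hP⟩ := h
  exact (hP N hN).1 U hU

theorem RelGF.exists_shortEx {N : ModuleCat.{u} R} (h : RelGF 𝒰 ℱ N) :
    ∃ (F K : ModuleCat.{u} R) (f : N →ₗ[R] F) (g : F →ₗ[R] K), ShortEx f g ∧ ℱ F ∧
      RelGF 𝒰 ℱ K := by
  obtain ⟨P, hN, hP⟩ := h
  obtain ⟨F, K, f, g, hs, hF, hK⟩ := (hP N hN).2
  exact ⟨F, K, f, g, hs, hF, P, hK, hP⟩

theorem RelGF.mono {N : ModuleCat.{u} R} (h : RelGF 𝒰 ℱ N) (hle : ∀ U, 𝒱 U → 𝒰 U) :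
    RelGF 𝒱 ℱ N := by
  obtain ⟨P, hN, hP⟩ := h
  exact ⟨P, hN, fun A hA => ⟨fun U hU => (hP A hA).1 U (hle U hU), (hP A hA).2⟩⟩

theorem RelGF.congr {N N' : ModuleCat.{u} R} (h : RelGF 𝒰 ℱ N) (e : N ≃ₗ[R] N') :
    RelGF 𝒰 ℱ N' := by
  refine ⟨fun A => ∃ N : ModuleCat.{u} R, RelGF 𝒰 ℱ N ∧ Nonempty (N ≃ₗ[R] A), ⟨N, h, ⟨e⟩⟩, ?_⟩
  rintro A ⟨N, hN, ⟨e⟩⟩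
  refine ⟨fun U hU => (hN.torAcyclic hU).congr_right e, ?_⟩
  obtain ⟨F, K, f, g, hs, hF, hK⟩ := hN.exists_shortEx
  exact ⟨F, K, _, g, hs.comp_equiv e.symm, hF, K, hK, ⟨.refl R K⟩⟩

/-- Modules with an injective left resolution of length `k` by syzygies that are
`Ext(U, -)`-acyclic for all `U` in `𝒰`. -/
def InjRes (𝒰 : ModuleCat.{u} R → Prop) : ℕ → ModuleCat.{u} R → Prop
  | 0, Y => ∀ U, 𝒰 U → ExtAcyclic R U Y
  | k + 1, Y => (∀ U, 𝒰 U → ExtAcyclic R U Y) ∧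
      ∃ (K E : ModuleCat.{u} R) (f : K →ₗ[R] E) (g : E →ₗ[R] Y), ShortEx f g ∧
        Module.Injective R E ∧ InjRes 𝒰 k K

namespace InjRes

theorem extAcyclic {k : ℕ} {Y : ModuleCat.{u} R} (h : InjRes 𝒰 k Y) {U : ModuleCat.{u} R}
    (hU : 𝒰 U) : ExtAcyclic R U Y := by
  cases k with
  | zero => exact h U hU
  | succ k => exact h.1 U hU

theorem of_injective (k : ℕ) (E : ModuleCat.{u} R) [Module.Injective R E] : InjRes 𝒰 k E := by
  induction k generalizing E with
  | zero => exact fun U _ => .of_injective _ _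
  | succ k ih =>
    have : Module.Injective R (ModuleCat.of R PUnit.{u + 1}) :=
      ⟨fun _ _ _ _ _ _ _ _ _ => ⟨0, fun _ => rfl⟩⟩
    exact ⟨fun U _ => .of_injective _ _, ModuleCat.of R PUnit.{u + 1}, E, 0, LinearMap.id,
      ⟨fun _ _ _ => rfl, fun x => by simp [eq_comm (a := (0 : E))], Function.surjective_id⟩,
      inferInstance, ih _⟩

variable (h𝒰 : ∀ I : ModuleCat.{u} R, Module.Injective R I → 𝒰 I)

theorem injective_prod (E E' : Type u) [AddCommGroup E] [Module R E] [AddCommGroup E']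
    [Module R E'] [hE : Module.Injective R E] [hE' : Module.Injective R E'] :
    Module.Injective R (E × E') where
  out X Y _ _ _ _ f hf g := by
    obtain ⟨a, ha⟩ := hE.out f hf (LinearMap.fst R E E' ∘ₗ g)
    obtain ⟨b, hb⟩ := hE'.out f hf (LinearMap.snd R E E' ∘ₗ g)
    exact ⟨a.prod b, fun x => Prod.ext (ha x) (hb x)⟩

include h𝒰

theorem mid {k : ℕ} {X Y Z : ModuleCat.{u} R} {a : X →ₗ[R] Y} {b : Y →ₗ[R] Z}
    (h : ShortEx a b) (hX : InjRes 𝒰 k X) (hZ : InjRes 𝒰 k Z) : InjRes 𝒰 k Y := by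
  induction k generalizing X Y Z with
  | zero => exact fun U hU => h.extAcyclic_mid (hX U hU) (hZ U hU)
  | succ k ih =>
    refine ⟨fun U hU => h.extAcyclic_mid (hX.1 U hU) (hZ.1 U hU), ?_⟩
    obtain ⟨hX, K₂, E₂, i₂, p₂, h₂, hE₂, hK₂⟩ := hX
    obtain ⟨hZ, K₁, E₁, i₁, p₁, h₁, hE₁, hK₁⟩ := hZ
    -- The horseshoe needs Ext¹(E₁, X) = 0. It holds because the injective `E₁` is itself in the
    -- test class, by `h𝒰`.
    obtain ⟨q, hq⟩ := h.lifting (hX E₁ (h𝒰 _ hE₁)) p₁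
    obtain ⟨K, i, p, c, d, hs, hs'⟩ := h.exists_horseshoe h₂ h₁ q hq
    exact ⟨K, ModuleCat.of R (E₂ × E₁), i, p, hs, injective_prod _ _, ih hs' hK₂ hK₁⟩

theorem right {k : ℕ} {E Y Z : ModuleCat.{u} R} [Module.Injective R E] {a : E →ₗ[R] Y}
    {b : Y →ₗ[R] Z} (h : ShortEx a b) (hY : InjRes 𝒰 k Y) : InjRes 𝒰 k Z := by
  cases k with
  | zero => exact fun U hU => h.extAcyclic_right (.of_injective _ _) (hY U hU)
  | succ k =>
    refine ⟨fun U hU => h.extAcyclic_right (.of_injective _ _) (hY.1 U hU), ?_⟩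
    obtain ⟨hY, K, E₁, i, p, h₁, hE₁, hK⟩ := hY
    obtain ⟨L, i', c, d, hs, hs'⟩ := h.exists_comp_ker h₁
    exact ⟨L, E₁, i', _, hs, hE₁, mid h𝒰 hs' hK (of_injective k E)⟩

/-- Compare the given cover E → Y with the resolving cover E₁ → Y. The Schanuel pullback P is an
extension of E by the resolvable kernel of E₁ → Y, and X is the quotient of P by the injective E₁.
One unit of length is lost. -/
theorem left {k : ℕ} {X E Y : ModuleCat.{u} R} [Module.Injective R E] {a : X →ₗ[R] E}
    {b : E →ₗ[R] Y} (h : ShortEx a b) (hX : ∀ I : ModuleCat.{u} R, Module.Injective R I →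
    ExtAcyclic R I X) (hY : InjRes 𝒰 (k + 1) Y) : InjRes 𝒰 k X := by
  obtain ⟨hY, K, E₁, i, p, h₁, hE₁, hK⟩ := hY
  obtain ⟨s, hs⟩ := h.lifting (hX E₁ hE₁) p
  obtain ⟨P, _, _, _, _, h₂, h₃⟩ := h₁.exists_schanuel h s hs
  exact right h𝒰 h₃ (mid h𝒰 h₂ hK (of_injective k E))

end InjRes

/-- The dual of a module in `RelGF` has injective left resolutions of any length. -/
theorem RelGF.injRes {N : ModuleCat.{u} R} (h : RelGF 𝒰 (fun F => Module.Flat R F) N) (k : ℕ)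
    (J : Type u) [AddCommGroup J] [Module R J] [Module.Injective R J] :
    InjRes 𝒰 k (ModuleCat.of R (N →ₗ[R] J)) := by
  induction k generalizing N with
  | zero => exact fun U hU => h.torAcyclic hU J
  | succ k ih =>
    obtain ⟨F, K, f, g, hs, hF, hK⟩ := h.exists_shortEx
    exact ⟨fun U hU => h.torAcyclic hU J, ModuleCat.of R (K →ₗ[R] J),
      ModuleCat.of R (F →ₗ[R] J), _, _, hs.dual J, injective_hom_of_flat F J, ih hK⟩

/-- If the class of Gorenstein flat modules is closed under extensions, then so is the class
relative to any larger test class. -/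
theorem RelGF.mid (h𝒰 : ∀ I : ModuleCat.{u} R, Module.Injective R I → 𝒰 I)
    (hG : ∀ (X Y Z : ModuleCat.{u} R) (f : X →ₗ[R] Y) (g : Y →ₗ[R] Z), ShortEx f g →
      RelGF (fun I => Module.Injective R I) (fun F => Module.Flat R F) X →
      RelGF (fun I => Module.Injective R I) (fun F => Module.Flat R F) Z →
      RelGF (fun I => Module.Injective R I) (fun F => Module.Flat R F) Y)
    {X Y Z : ModuleCat.{u} R} {f : X →ₗ[R] Y} {g : Y →ₗ[R] Z} (h : ShortEx f g)
    (hX : RelGF 𝒰 (fun F => Module.Flat R F) X) (hZ : RelGF 𝒰 (fun F => Module.Flat R F) Z) :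
    RelGF 𝒰 (fun F => Module.Flat R F) Y := by
  -- The invariant asks for every length `k` at once, since passing from `A` to its cosyzygy uses up
  -- one step.
  refine ⟨fun A => RelGF (fun I => Module.Injective R I) (fun F => Module.Flat R F) A ∧
    ∀ (k : ℕ) (J : ModuleCat.{u} R) [Module.Injective R J],
      InjRes 𝒰 k (ModuleCat.of R (A →ₗ[R] J)), ⟨hG X Y Z f g h (hX.mono h𝒰) (hZ.mono h𝒰),
    fun k J _ => InjRes.mid h𝒰 (h.dual J) (hZ.injRes k J) (hX.injRes k J)⟩, ?_⟩
  rintro A ⟨hA, hA'⟩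
  refine ⟨fun U hU J _ _ _ => (hA' 0 (ModuleCat.of R J)).extAcyclic hU, ?_⟩
  obtain ⟨F, K, f, g, hs, hF, hK⟩ := hA.exists_shortEx
  refine ⟨F, K, f, g, hs, hF, hK, fun k J _ => ?_⟩
  have : Module.Injective R (ModuleCat.of R (F →ₗ[R] J)) := injective_hom_of_flat F J
  -- The comparison of covers needs Ext(I, Hom(K, J)) = 0 for injective I, which is part of the
  -- Gorenstein flatness of `K`.
  exact InjRes.left h𝒰 (X := ModuleCat.of R (K →ₗ[R] J)) (E := ModuleCat.of R (F →ₗ[R] J))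
    (Y := ModuleCat.of R (A →ₗ[R] J)) (hs.dual J) (fun I hI => hK.torAcyclic hI J) (hA' (k + 1) J)

/-- Stability: if `RelGF` is closed under extensions, a class of `Tor`-acyclic modules whose
members embed into modules of `RelGF` with quotient in the class is contained in `RelGF`. -/
theorem RelGF.of_coresolving
    (hG : ∀ (X Y Z : ModuleCat.{u} R) (f : X →ₗ[R] Y) (g : Y →ₗ[R] Z), ShortEx f g →
      RelGF 𝒰 ℱ X → RelGF 𝒰 ℱ Z → RelGF 𝒰 ℱ Y) (P : ModuleCat.{u} R → Prop)
    (hP : ∀ Z, P Z → (∀ U, 𝒰 U → TorAcyclic R U Z) ∧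
      ∃ (S Z' : ModuleCat.{u} R) (f : Z →ₗ[R] S) (g : S →ₗ[R] Z'), ShortEx f g ∧
        RelGF 𝒰 ℱ S ∧ P Z') {N : ModuleCat.{u} R} (hN : P N) : RelGF 𝒰 ℱ N := by
  -- The class `P` itself is not stable under flat cosyzygies; the class of kernels of epimorphisms
  -- from `RelGF` onto `P` is.
  refine ⟨fun A => ∃ (S Z : ModuleCat.{u} R) (f : A →ₗ[R] S) (g : S →ₗ[R] Z), ShortEx f g ∧
    RelGF 𝒰 ℱ S ∧ P Z, (hP N hN).2, ?_⟩
  rintro A ⟨G, Z, α, β, hs, hG', hZ⟩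
  obtain ⟨hZT, S, Z', i, p, hs', hS, hZ'⟩ := hP Z hZ
  refine ⟨fun U hU => hs.torAcyclic_left (hG'.torAcyclic hU) (hZT U hU), ?_⟩
  obtain ⟨F, G₁, γ, δ, h₁, hF, hG₁⟩ := hG'.exists_shortEx
  -- Embedding `G` into the flat-type module `F` gives Q = F/A as an extension of `G₁` by `Z`.
  -- Pushing out along Z → S yields `H`, an extension of `G₁` by `S` and hence in `RelGF`, with Q →
  -- H and cokernel `Z'`: `Q` has the invariant again.
  obtain ⟨Q, q, a, b, h₂, h₃⟩ := hs.exists_comp h₁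
  obtain ⟨H, a', b', c, d, h₄, h₅⟩ := h₃.exists_pushout hs'
  exact ⟨F, Q, _, q, h₂, hF, H, Z', c, d, h₅, hG _ _ _ _ _ h₄ hS hG₁, hZ'⟩

end RelativeGorenstein

/-! ### Cutting exact sequences into short ones and splicing them back -/

theorem ShortEx.exact_splice {R X Y Z W V : Type u} [CommRing R] [AddCommGroup X] [Module R X]
    [AddCommGroup Y] [Module R Y] [AddCommGroup Z] [Module R Z] [AddCommGroup W] [Module R W]
    [AddCommGroup V] [Module R V] {f : X →ₗ[R] Y} {g : Y →ₗ[R] Z} (h : ShortEx f g)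
    {p : W →ₗ[R] X} (hp : Function.Surjective p) {i : Z →ₗ[R] V} (hi : Function.Injective i) :
    Function.Exact (f ∘ₗ p) (i ∘ₗ g) := by
  intro y
  rw [LinearMap.comp_apply, map_eq_zero_iff i hi, h.exact y]
  constructor
  · rintro ⟨x, rfl⟩
    obtain ⟨w, rfl⟩ := hp x
    exact ⟨w, rfl⟩
  · rintro ⟨w, rfl⟩
    exact ⟨p w, rfl⟩

namespace ExactSeq

variable {R : Type u} [CommRing R] (S : ExactSeq R)

/-- The short exact sequence `0 ⟶ im (d i) ⟶ X (i + 1) ⟶ im (d (i + 1)) ⟶ 0`. -/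
theorem shortEx (i : ℤ) :
    ShortEx (LinearMap.range (S.d i)).subtype (S.d (i + 1)).rangeRestrict :=
  .range _ (S.exact i)

theorem lTensor_injective {A : Type u} [AddCommGroup A] [Module R A] (h : S.TensorExact A)
    (i : ℤ) : Function.Injective ((LinearMap.range (S.d i)).subtype.lTensor A) := by
  obtain ⟨i, rfl⟩ : ∃ j, i = j + 1 := ⟨i - 1, by ring⟩
  rw [injective_iff_map_eq_zero]
  intro t ht
  obtain ⟨y, rfl⟩ := LinearMap.lTensor_surjective A (S.d (i + 1)).surjective_rangeRestrict t
  rw [← LinearMap.comp_apply, ← LinearMap.lTensor_comp] at ht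
  obtain ⟨x, rfl⟩ := (h i y).1 ht
  rw [← LinearMap.comp_apply, ← LinearMap.lTensor_comp]
  have : (S.d (i + 1)).rangeRestrict ∘ₗ S.d i = 0 :=
    LinearMap.ext fun x => Subtype.ext ((S.exact i (S.d i x)).2 ⟨x, rfl⟩)
  rw [this, LinearMap.lTensor_zero, LinearMap.zero_apply]

theorem range_lifting {A : Type u} [AddCommGroup A] [Module R A] (h : S.HomExact A) (i : ℤ)
    (k : A →ₗ[R] LinearMap.range (S.d (i + 1))) :
    ∃ l : A →ₗ[R] S.X (i + 1), (S.d (i + 1)).rangeRestrict ∘ₗ l = k := by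
  obtain ⟨l, hl⟩ := (h (i + 1) ((LinearMap.range (S.d (i + 1))).subtype ∘ₗ k)).1
    (LinearMap.ext fun a => (S.shortEx (i + 1)).apply_apply (k a) |> congrArg Subtype.val)
  exact ⟨l, LinearMap.ext fun a => Subtype.ext (LinearMap.congr_fun hl a)⟩

/-- The terms to the left resolve the image by Tor-acyclic modules, so only indices up to `n`
matter. -/
theorem torAcyclic_range {A : Type u} [AddCommGroup A] [Module R A] (h : S.TensorExact A)
    (n : ℤ) (hX : ∀ i ≤ n, TorAcyclic R A (S.X i)) (i : ℤ) (hi : i ≤ n) :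
    TorAcyclic R A (LinearMap.range (S.d i)) := by
  refine TorAcyclic.of_resolving
    (fun Z => ∃ i ≤ n, Z = ModuleCat.of R (LinearMap.range (S.d i))) ?_ _ ⟨i, hi, rfl⟩
  rintro _ ⟨i, hi, rfl⟩
  obtain ⟨i, rfl⟩ : ∃ j, i = j + 1 := ⟨i - 1, by ring⟩
  exact ⟨S.X (i + 1), ModuleCat.of R (LinearMap.range (S.d i)), _, _, S.shortEx i, hX _ hi,
    S.lTensor_injective h i, i, by lia, rfl⟩

theorem relGF {𝒰 ℱ : ModuleCat.{u} R → Prop} (hT : ∀ i U, 𝒰 U → TorAcyclic R U (S.X i))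
    (hF : ∀ i, 1 ≤ i → ℱ (S.X i)) (hU : ∀ U, 𝒰 U → S.TensorExact U) {N : ModuleCat.{u} R}
    (hN : S.HasImage N) : RelGF 𝒰 ℱ N := by
  obtain ⟨e⟩ := hN
  refine RelGF.congr (N := ModuleCat.of R (LinearMap.range (S.d 0))) ?_ e.symm
  refine ⟨fun A => ∃ i, 0 ≤ i ∧ A = ModuleCat.of R (LinearMap.range (S.d i)),
    ⟨0, le_rfl, rfl⟩, ?_⟩
  rintro _ ⟨i, hi, rfl⟩
  exact ⟨fun U h => S.torAcyclic_range (hU U h) i (fun j _ => hT j U h) i le_rfl,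
    S.X (i + 1), ModuleCat.of R (LinearMap.range (S.d (i + 1))), _, _, S.shortEx i,
    hF _ (by lia), i + 1, by lia, rfl⟩

variable {S}

/-- Splicing a doubly infinite family of short exact sequences. -/
def splice (Z X : ℤ → ModuleCat.{u} R) (ι : ∀ i, Z i →ₗ[R] X i)
    (π : ∀ i, X i →ₗ[R] Z (i + 1)) (h : ∀ i, ShortEx (ι i) (π i)) : ExactSeq R where
  X := X
  d i := ι (i + 1) ∘ₗ π i
  exact i := (h (i + 1)).exact_splice (h i).surj (h (i + 1 + 1)).inj

section splice

variable {Z X : ℤ → ModuleCat.{u} R} {ι : ∀ i, Z i →ₗ[R] X i}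
  {π : ∀ i, X i →ₗ[R] Z (i + 1)} (h : ∀ i, ShortEx (ι i) (π i))

theorem splice_hasImage : (splice Z X ι π h).HasImage (Z 1) := by
  have hr : LinearMap.range ((splice Z X ι π h).d 0) = LinearMap.range (ι 1) :=
    LinearMap.range_comp_of_range_eq_top _ (LinearMap.range_eq_top.2 (h 0).surj)
  exact ⟨(LinearEquiv.ofInjective _ (h 1).inj).trans (LinearEquiv.ofEq _ _ hr.symm)⟩

theorem splice_tensorExact {A : Type u} [AddCommGroup A] [Module R A]
    (hi : ∀ i, Function.Injective ((ι i).lTensor A)) : (splice Z X ι π h).TensorExact A := by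
  intro i
  have := ((h (i + 1)).lTensor (hi (i + 1))).exact_splice
    (LinearMap.lTensor_surjective A (h i).surj) (hi (i + 1 + 1))
  rwa [← LinearMap.lTensor_comp, ← LinearMap.lTensor_comp] at this

theorem splice_homExact {A : Type u} [AddCommGroup A] [Module R A]
    (hl : ∀ i (k : A →ₗ[R] Z (i + 1)), ∃ l : A →ₗ[R] X i, π i ∘ₗ l = k) :
    (splice Z X ι π h).HomExact A := by
  intro i k
  constructor
  · intro hk
    obtain ⟨l, rfl⟩ := (h (i + 1)).exists_lift k (LinearMap.ext fun a =>
      (h (i + 1 + 1)).inj ((LinearMap.congr_fun hk a).trans (map_zero _).symm))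
    obtain ⟨m, rfl⟩ := hl i l
    exact ⟨m, rfl⟩
  · rintro ⟨m, rfl⟩
    refine LinearMap.ext fun a => ?_
    change ι (i + 1 + 1) (π (i + 1) (ι (i + 1) (π i (m a)))) = 0
    rw [(h (i + 1)).apply_apply, map_zero]

end splice

end ExactSeq

/-- Iterated choices to the right and to the left, glued at `a`; they produce the two halves of a
complete resolution. -/
theorem exists_int_chain {α : Type*} (r s : α → α → Prop) (P Q : α → Prop)
    (hP : ∀ a, P a → ∃ b, r a b ∧ P b) (hQ : ∀ a, Q a → ∃ b, s b a ∧ Q b) (a : α)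
    (ha : P a) (ha' : Q a) : ∃ W : ℤ → α, W 0 = a ∧ (∀ i, 0 ≤ i → r (W i) (W (i + 1))) ∧
      ∀ i, i < 0 → s (W i) (W (i + 1)) := by
  choose! f hf hfP using hP
  choose! g hg hgQ using hQ
  have hp : ∀ n : ℕ, P (f^[n] a) := fun n => by
    induction n with
    | zero => exact ha
    | succ n ih => rw [Function.iterate_succ_apply']; exact hfP _ ih
  have hq : ∀ n : ℕ, Q (g^[n] a) := fun n => by
    induction n with
    | zero => exact ha'
    | succ n ih => rw [Function.iterate_succ_apply']; exact hgQ _ ih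
  let W : ℤ → α := fun i => if 0 ≤ i then f^[i.toNat] a else g^[(-i).toNat] a
  have hW : ∀ n : ℕ, W n = f^[n] a := fun n => by simp [W]
  have hW' : ∀ n : ℕ, W (-n) = g^[n] a := fun n => by
    rcases n with _ | n
    · simp [W]
    · have : ¬ (0 : ℤ) ≤ -((n + 1 : ℕ) : ℤ) := by lia
      simp only [W, if_neg this, neg_neg, Int.toNat_natCast]
  refine ⟨W, hW 0, fun i hi => ?_, fun i hi => ?_⟩
  · obtain ⟨n, rfl⟩ := Int.eq_ofNat_of_zero_le hi
    have := hW (n + 1)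
    rw [Nat.cast_succ] at this
    rw [hW, this, Function.iterate_succ_apply']
    exact hf _ (hp n)
  · obtain ⟨n, rfl⟩ : ∃ n : ℕ, i = -((n + 1 : ℕ) : ℤ) := ⟨(-i - 1).toNat, by lia⟩
    have : -((n + 1 : ℕ) : ℤ) + 1 = -(n : ℤ) := by push_cast; ring
    rw [this, hW', hW', Function.iterate_succ_apply']
    exact hg _ (hq n)

/-! ### Complete resolutions and the Gorenstein step -/

section Construction

variable {R : Type u} [CommRing R] {𝒰 ℱ : ModuleCat.{u} R → Prop}

/-- The right half unfolds the definition of `RelGF`. The left half is a free resolution, whose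
syzygies inherit Tor-acyclicity and so keep the tensored sequence exact. -/
theorem RelGF.exists_exactSeq {N : ModuleCat.{u} R} (h : RelGF 𝒰 ℱ N) :
    ∃ S : ExactSeq R, (∀ i : ℤ, i ≤ 0 → Module.Flat R (S.X i)) ∧ (∀ i : ℤ, 1 ≤ i → ℱ (S.X i)) ∧
      S.HasImage N ∧ ∀ U, 𝒰 U → S.TensorExact U := by
  let mid (𝒢 : ModuleCat.{u} R → Prop) (A B : ModuleCat.{u} R) : Prop :=
    ∃ (E : ModuleCat.{u} R) (f : A →ₗ[R] E) (g : E →ₗ[R] B), ShortEx f g ∧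
      𝒢 E ∧ ∀ U, 𝒰 U → Function.Injective (f.lTensor U)
  let 𝒯 (A : ModuleCat.{u} R) : Prop := ∀ U, 𝒰 U → TorAcyclic R U A
  obtain ⟨W, rfl, hr, hs⟩ := exists_int_chain (mid ℱ) (mid fun F => Module.Flat R F)
    (RelGF 𝒰 ℱ) 𝒯 (fun A hA => by
      obtain ⟨F, K, f, g, hs, hF, hK⟩ := hA.exists_shortEx
      exact ⟨K, ⟨F, f, g, hs, hF, fun U hU => hs.lTensor_injective (hK.torAcyclic hU)⟩, hK⟩)
    (fun A hA => by
      obtain ⟨K, F, f, g, hs, hF⟩ := exists_free_presentation (R := R) A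
      exact ⟨K, ⟨F, f, g, hs, inferInstance, fun U hU => hs.lTensor_injective (hA U hU)⟩,
        fun U hU => hs.torAcyclic_left (.of_flat _ _) (hA U hU)⟩) N h
    (fun U hU => h.torAcyclic hU)
  -- The image in a spliced sequence is its syzygy of index 1, whereas the module sits at `W 0`;
  -- hence the shift by one.
  have key : ∀ i : ℤ, mid (fun E => (i ≤ 0 → Module.Flat R E) ∧ (1 ≤ i → ℱ E))
      (W (i - 1)) (W (i + 1 - 1)) := by
    intro i
    rw [show i + 1 - 1 = i - 1 + 1 by ring]
    rcases le_or_gt 1 i with hi | hi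
    · obtain ⟨E, f, g, hs, hE, hU⟩ := hr (i - 1) (by lia)
      exact ⟨E, f, g, hs, ⟨fun h => by lia, fun _ => hE⟩, hU⟩
    · obtain ⟨E, f, g, hs, hE, hU⟩ := hs (i - 1) (by lia)
      exact ⟨E, f, g, hs, ⟨fun _ => hE, fun h => by lia⟩, hU⟩
  choose X ι π hS hX hU using key
  refine ⟨ExactSeq.splice (fun i => W (i - 1)) X ι π hS, fun i => (hX i).1, fun i => (hX i).2,
    ExactSeq.splice_hasImage hS, fun U h => ExactSeq.splice_tensorExact hS fun i => hU i U h⟩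

theorem gorensteinFlat_iff {N : ModuleCat.{u} R} : GorensteinFlat R N ↔
    RelGF (fun I => Module.Injective R I) (fun F => Module.Flat R F) N := by
  constructor
  · rintro ⟨S, hS, hN, hU⟩
    exact S.relGF (fun i U _ => have := hS i; .of_flat _ _) (fun i _ => hS i)
      (fun U h => hU U h) hN
  · intro h
    obtain ⟨S, h1, h2, hN, hU⟩ := h.exists_exactSeq
    exact ⟨S, fun i => (le_or_gt i 0).elim (h1 i) (h2 i), hN,
      fun I _ _ hI => hU (ModuleCat.of R I) hI⟩

theorem IsGFClosed.relGF_mid (hR : IsGFClosed R)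
    {h𝒰 : ∀ I : ModuleCat.{u} R, Module.Injective R I → 𝒰 I}
    {X Y Z : ModuleCat.{u} R} {f : X →ₗ[R] Y} {g : Y →ₗ[R] Z} (h : ShortEx f g)
    (hX : RelGF 𝒰 (fun F => Module.Flat R F) X) (hZ : RelGF 𝒰 (fun F => Module.Flat R F) Z) :
    RelGF 𝒰 (fun F => Module.Flat R F) Y := by
  refine RelGF.mid h𝒰 (fun X Y Z f g h hX hZ => ?_) h hX hZ
  rw [← gorensteinFlat_iff] at hX hZ ⊢
  exact hR.prop_X₂_of_shortExact h.shortExact hX hZ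

/-- Every module of a class containing a zero module is obtained by the Gorenstein
construction. -/
theorem gorStep_of_mem {𝒳 : ObjectProperty (ModuleCat.{u} R)} {O M : ModuleCat.{u} R}
    (hO : 𝒳 O) [Subsingleton O] (hM : 𝒳 M) : gorStep 𝒳 M := by
  -- These are the syzygies of ⋯ → O → M = M → O → ⋯. All its short exact pieces split, so both
  -- exactness tests are automatic.
  let W : ℤ → ModuleCat.{u} R := fun i => if i = 1 then M else O
  have key : ∀ i, ∃ (E : ModuleCat.{u} R) (f : W i →ₗ[R] E) (g : E →ₗ[R] W (i + 1))
      (s : W (i + 1) →ₗ[R] E) (r : E →ₗ[R] W i), ShortEx f g ∧ 𝒳 E ∧ g ∘ₗ s = LinearMap.id ∧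
        r ∘ₗ f = LinearMap.id := by
    intro i
    by_cases hi : i = 1
    · have h1 : Subsingleton (W (i + 1)) := by simp only [W]; rw [if_neg (by lia)]; infer_instance
      have h2 : 𝒳 (W i) := by simp only [W]; rwa [if_pos hi]
      exact ⟨W i, LinearMap.id, 0, 0, LinearMap.id, ⟨Function.injective_id,
        fun x => by simp, fun x => ⟨0, Subsingleton.elim _ _⟩⟩, h2,
        LinearMap.ext fun x => Subsingleton.elim _ _, rfl⟩
    · have h1 : Subsingleton (W i) := by simp only [W]; rw [if_neg hi]; infer_instance
      have h2 : 𝒳 (W (i + 1)) := by simp only [W]; split_ifs <;> assumption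
      exact ⟨W (i + 1), 0, LinearMap.id, LinearMap.id, 0, ⟨fun _ _ _ => Subsingleton.elim _ _,
        fun x => by simp [eq_comm (a := (0 : W (i + 1)))], Function.surjective_id⟩, h2, rfl,
        LinearMap.ext fun x => Subsingleton.elim _ _⟩
  choose X ι π s r hS hX hs hr using key
  refine ⟨ExactSeq.splice W X ι π hS, hX, ExactSeq.splice_hasImage hS,
    fun A _ => ExactSeq.splice_homExact hS fun i k => ⟨s i ∘ₗ k, ?_⟩,
    fun A _ => ExactSeq.splice_tensorExact hS fun i => ?_⟩
  · rw [← LinearMap.comp_assoc, hs, LinearMap.id_comp]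
  · refine Function.LeftInverse.injective (g := (r i).lTensor _) fun x => ?_
    rw [← LinearMap.comp_apply, ← LinearMap.lTensor_comp, hr, LinearMap.lTensor_id,
      LinearMap.id_apply]

end Construction

/-! ### Comparison with Tor defined by derived functors -/

section Syzygies

variable {R : Type u} [CommRing R]

/-- The syzygies of a projective resolution. -/
theorem exists_syzygies {A : ModuleCat.{u} R} (P : ProjectiveResolution A) :
    ∃ (K : ℕ → ModuleCat.{u} R) (ι : ∀ n, K (n + 1) →ₗ[R] P.complex.X n)
      (π : ∀ n, P.complex.X n →ₗ[R] K n), K 0 = A ∧ (∀ n, ShortEx (ι n) (π n)) ∧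
      ∀ n, (P.complex.d (n + 1) n).hom = ι n ∘ₗ π (n + 1) := by
  let K : ℕ → ModuleCat.{u} R := fun n => match n with
    | 0 => A
    | n + 1 => ModuleCat.of R (LinearMap.range (P.complex.d (n + 1) n).hom)
  let ι : ∀ n, K (n + 1) →ₗ[R] P.complex.X n := fun n =>
    (LinearMap.range (P.complex.d (n + 1) n).hom).subtype
  let p₀ : P.complex.X 0 ⟶ A := P.π.f 0
  have hp₀ : Function.Surjective p₀.hom :=
    (ModuleCat.epi_iff_surjective _).1 (inferInstanceAs (Epi (P.π.f 0)))
  have hex₀ : Function.Exact (P.complex.d 1 0).hom p₀.hom := by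
    have := (ShortComplex.mk (P.complex.d 1 0) p₀ P.complex_d_comp_π_f_zero).exact_of_g_is_cokernel
      P.isColimitCokernelCofork
    exact (ShortComplex.ShortExact.moduleCat_exact_iff_function_exact _).1 this
  let π : ∀ n, P.complex.X n →ₗ[R] K n := fun n => match n with
    | 0 => p₀.hom
    | n + 1 => (P.complex.d (n + 1) n).hom.rangeRestrict
  refine ⟨K, ι, π, rfl, fun n => ?_, fun n => rfl⟩
  cases n with
  | zero =>
    have h := ShortEx.range _ hex₀
    exact ⟨h.inj, fun y => by
      rw [← h.exact y]
      exact ⟨fun hy => Subtype.ext hy, fun hy => congrArg Subtype.val hy⟩, hp₀⟩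
  | succ n =>
    exact ShortEx.range _
      ((ShortComplex.ShortExact.moduleCat_exact_iff_function_exact _).1 (P.exact_succ n))

theorem isZero_tor_succ_iff {A : ModuleCat.{u} R} (P : ProjectiveResolution A)
    (C : Type u) [AddCommGroup C] [Module R C] (n : ℕ) :
    Limits.IsZero (((Tor (ModuleCat.{u} R) (n + 1)).obj (ModuleCat.of R C)).obj A) ↔
      Function.Exact ((P.complex.d (n + 2) (n + 1)).hom.lTensor C)
        ((P.complex.d (n + 1) n).hom.lTensor C) := by
  let F := (MonoidalCategory.tensoringLeft (ModuleCat.{u} R)).obj (ModuleCat.of R C)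
  rw [show ((Tor (ModuleCat.{u} R) (n + 1)).obj (ModuleCat.of R C)).obj A =
    (F.leftDerived (n + 1)).obj A from rfl, (P.isoLeftDerivedObj F (n + 1)).isZero_iff]
  change Limits.IsZero (HomologicalComplex.homology _ _) ↔ _
  rw [← HomologicalComplex.exactAt_iff_isZero_homology,
    HomologicalComplex.exactAt_iff' _ (n + 2) (n + 1) n (by simp)
      (by simp only [ChainComplex.next_nat_succ]),
    ShortComplex.ShortExact.moduleCat_exact_iff_function_exact]
  exact Iff.rfl

/-- Vanishing of Mathlib's `Tor` in positive degrees is `TorAcyclic`. -/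
theorem isZero_tor_iff {A C : Type u} [AddCommGroup C] [Module R C] [AddCommGroup A]
    [Module R A] :
    (∀ n : ℕ, 1 ≤ n → Limits.IsZero
      (((Tor (ModuleCat.{u} R) n).obj (ModuleCat.of R C)).obj (ModuleCat.of R A))) ↔
      TorAcyclic R C A := by
  let P := projectiveResolution (ModuleCat.of R A)
  obtain ⟨K, ι, π, hK, hs, hd⟩ := exists_syzygies P
  have hflat : ∀ n, Module.Flat R (P.complex.X n) := fun n =>
    have : Module.Projective R (P.complex.X n) :=
      (IsProjective.iff_projective _).2 (P.projective n)
    inferInstance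
  -- Tor in degree n + 1 is the kernel of C ⊗ K (n + 1) → C ⊗ P n.
  have key : ∀ n, Limits.IsZero
      (((Tor (ModuleCat.{u} R) (n + 1)).obj (ModuleCat.of R C)).obj (ModuleCat.of R A)) ↔
      Function.Injective ((ι n).lTensor C) := by
    intro n
    rw [isZero_tor_succ_iff P, hd, hd, LinearMap.lTensor_comp, LinearMap.lTensor_comp]
    have hex := lTensor_exact C (hs (n + 1)).exact (hs (n + 1)).surj
    have hsu := LinearMap.lTensor_surjective C (hs (n + 1)).surj
    have hsu' := LinearMap.lTensor_surjective C (hs (n + 1 + 1)).surj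
    constructor
    · intro h
      rw [injective_iff_map_eq_zero]
      intro t ht
      obtain ⟨y, rfl⟩ := hsu t
      obtain ⟨x, rfl⟩ := (h y).1 ht
      exact hex.apply_apply_eq_zero _
    · intro h y
      rw [LinearMap.comp_apply, map_eq_zero_iff _ h, hex y]
      constructor
      · rintro ⟨z, rfl⟩
        obtain ⟨x, rfl⟩ := hsu' z
        exact ⟨x, rfl⟩
      · rintro ⟨x, rfl⟩
        exact ⟨_, rfl⟩
  have hT : TorAcyclic R C (K 0) ↔ TorAcyclic R C A := by rw [hK]
  rw [← hT]
  constructor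
  · intro h
    refine TorAcyclic.of_resolving (fun Z => ∃ n, Z = K n) ?_ _ ⟨0, rfl⟩
    rintro _ ⟨n, rfl⟩
    have := hflat n
    exact ⟨_, _, _, _, hs n, .of_flat _ _, (key n).1 (h _ (by lia)), n + 1, rfl⟩
  · intro h n hn
    have hKn : ∀ n, TorAcyclic R C (K n) := fun n => by
      induction n with
      | zero => exact h
      | succ n ih =>
        have := hflat n
        exact (hs n).torAcyclic_left (.of_flat _ _) ih
    obtain ⟨n, rfl⟩ := Nat.exists_eq_add_of_le' hn
    exact (key n).2 ((hs n).lTensor_injective (hKn n))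

end Syzygies

/-! ### Tensor and Hom evaluation for finitely presented modules -/

section FinitelyPresented

variable {R : Type u} [CommRing R]

/-- Tensor evaluation `F ⊗ Hom(K, B) → Hom(K, F ⊗ B)` is bijective for flat `F` and finitely
presented `K`. -/
theorem lTensorHomToHomLTensor_bijective (F K B : Type u) [AddCommGroup F] [Module R F]
    [AddCommGroup K] [Module R K] [AddCommGroup B] [Module R B] [Module.Flat R F]
    [Module.FinitePresentation R K] :
    Function.Bijective (lTensorHomToHomLTensor (.id R) K F B) := by
  obtain ⟨n, m, f, g, hf, hgf⟩ := Module.FinitePresentation.exists_fin' R K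
  have hfree : ∀ n : ℕ, Function.Bijective (lTensorHomToHomLTensor (.id R) (Fin n → R) F B) := by
    intro n
    rw [← lTensorHomEquivHomLTensor_toLinearMap]
    exact LinearEquiv.bijective _
  have hnat : ∀ {L L' : Type u} [AddCommGroup L] [Module R L] [AddCommGroup L'] [Module R L']
      (p : L →ₗ[R] L') (t : F ⊗[R] (L' →ₗ[R] B)),
      lTensorHomToHomLTensor (.id R) L F B ((p.lcomp R B).lTensor F t) =
        lTensorHomToHomLTensor (.id R) L' F B t ∘ₗ p := by
    intro L L' _ _ _ _ p t
    induction t with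
    | zero => simp
    | add x y hx hy => simp only [map_add, hx, hy, LinearMap.add_comp]
    | tmul x y => rfl
  have hfinj : Function.Injective ((f.lcomp R B).lTensor F) :=
    Module.Flat.lTensor_preserves_injective_linearMap _ fun a b hab => LinearMap.ext fun k => by
      obtain ⟨x, rfl⟩ := hf k
      exact LinearMap.congr_fun hab x
  have hfg : Function.Exact (f.lcomp R B) (g.lcomp R B) := fun k =>
    ⟨fun hk => exists_desc_of_exact hgf hf k hk, by
      rintro ⟨l, rfl⟩
      exact LinearMap.ext fun x => by simp [hgf.apply_apply_eq_zero]⟩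
  constructor
  · rw [injective_iff_map_eq_zero]
    intro t ht
    apply hfinj
    apply (hfree n).1
    rw [hnat, ht, map_zero, map_zero, LinearMap.zero_comp]
  · intro k
    obtain ⟨t, ht⟩ := (hfree n).2 (k ∘ₗ f)
    obtain ⟨s, rfl⟩ := (Module.Flat.lTensor_exact F hfg t).1 (by
      apply (hfree m).1
      rw [hnat, ht, map_zero]
      exact LinearMap.ext fun x => by simp [hgf.apply_apply_eq_zero])
    refine ⟨s, LinearMap.ext fun y => ?_⟩
    obtain ⟨x, rfl⟩ := hf y
    rw [hnat] at ht
    exact LinearMap.congr_fun ht x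

/-- Homomorphism evaluation `Hom(B, I) ⊗ K → Hom(Hom(K, B), I)`. -/
noncomputable def homEval (K B I : Type u) [AddCommGroup K] [Module R K] [AddCommGroup B]
    [Module R B] [AddCommGroup I] [Module R I] :
    (B →ₗ[R] I) ⊗[R] K →ₗ[R] (K →ₗ[R] B) →ₗ[R] I :=
  TensorProduct.lift (LinearMap.mk₂ R (fun φ x => φ ∘ₗ LinearMap.applyₗ x)
    (fun _ _ _ => rfl) (fun _ _ _ => rfl)
    (fun φ x y => by ext; simp) (fun c φ x => by ext; simp))

@[simp]
theorem homEval_tmul {K B I : Type u} [AddCommGroup K] [Module R K] [AddCommGroup B]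
    [Module R B] [AddCommGroup I] [Module R I] (φ : B →ₗ[R] I) (x : K) (f : K →ₗ[R] B) :
    homEval K B I (φ ⊗ₜ x) f = φ (f x) := rfl

theorem homEval_lTensor {K L B I : Type u} [AddCommGroup K] [Module R K] [AddCommGroup L]
    [Module R L] [AddCommGroup B] [Module R B] [AddCommGroup I] [Module R I] (p : K →ₗ[R] L)
    (t : (B →ₗ[R] I) ⊗[R] K) :
    homEval L B I (p.lTensor _ t) = homEval K B I t ∘ₗ p.lcomp R B := by
  induction t with
  | zero => simp
  | add x y hx hy => simp only [map_add, hx, hy, LinearMap.add_comp]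
  | tmul x y => rfl

theorem homEval_bijective_pi (n : ℕ) (B I : Type u) [AddCommGroup B] [Module R B]
    [AddCommGroup I] [Module R I] : Function.Bijective (homEval (R := R) (Fin n → R) B I) := by
  -- `s i b` is the map x ↦ xᵢ b. The inverse of evaluation sends Φ to the sum of (Φ ∘ sᵢ) ⊗ eᵢ.
  let s (i : Fin n) : B →ₗ[R] (Fin n → R) →ₗ[R] B :=
    LinearMap.flip (LinearMap.lsmul R B ∘ₗ LinearMap.proj i)
  have hs : ∀ i b x, s i b x = x i • b := fun _ _ _ => rfl
  have hsum : ∀ f : (Fin n → R) →ₗ[R] B, f = ∑ i, s i (f (Pi.single i 1)) := by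
    intro f
    ext i
    simp [hs, Pi.single_apply, ite_smul]
  have hsingle : ∀ x : Fin n → R, x = ∑ i, x i • Pi.single i (1 : R) := fun x => by
    simpa using (Pi.basisFun R (Fin n)).sum_repr x |>.symm
  constructor
  · rw [injective_iff_map_eq_zero]
    intro t ht
    have key : t = ∑ i, (homEval (Fin n → R) B I t ∘ₗ s i) ⊗ₜ[R] Pi.single i (1 : R) := by
      clear ht
      induction t with
      | zero => simp
      | add x y hx hy =>
        simp only [map_add, LinearMap.add_comp, TensorProduct.add_tmul, Finset.sum_add_distrib]
        rw [← hx, ← hy]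
      | tmul φ x =>
        have : ∀ i, homEval (Fin n → R) B I (φ ⊗ₜ x) ∘ₗ s i = x i • φ := fun i => by
          ext b; simp [hs]
        simp only [this, TensorProduct.smul_tmul, ← TensorProduct.tmul_sum]
        rw [← hsingle]
    rw [key, ht]
    simp
  · intro Φ
    refine ⟨∑ i, (Φ ∘ₗ s i) ⊗ₜ[R] Pi.single i (1 : R), LinearMap.ext fun f => ?_⟩
    rw [map_sum, LinearMap.sum_apply]
    simp only [homEval_tmul, LinearMap.comp_apply, ← map_sum]
    rw [← hsum]

/-- Homomorphism evaluation is bijective for injective `I` and finitely presented `K`. -/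
theorem homEval_bijective (K B I : Type u) [AddCommGroup K] [Module R K] [AddCommGroup B]
    [Module R B] [AddCommGroup I] [Module R I] [hI : Module.Injective R I]
    [Module.FinitePresentation R K] : Function.Bijective (homEval (R := R) K B I) := by
  obtain ⟨n, m, f, g, hf, hgf⟩ := Module.FinitePresentation.exists_fin' R K
  have hfg : Function.Exact (f.lcomp R B) (g.lcomp R B) := fun k =>
    ⟨fun hk => exists_desc_of_exact hgf hf k hk, by
      rintro ⟨l, rfl⟩
      exact LinearMap.ext fun x => by simp [hgf.apply_apply_eq_zero]⟩
  have hfinj : Function.Injective (f.lcomp R B) := fun a b hab => LinearMap.ext fun k => by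
    obtain ⟨x, rfl⟩ := hf k
    exact LinearMap.congr_fun hab x
  constructor
  · rw [injective_iff_map_eq_zero]
    intro t ht
    obtain ⟨t, rfl⟩ := LinearMap.lTensor_surjective _ hf t
    rw [homEval_lTensor] at ht
    have hex := ShortEx.range (g.lcomp R B) hfg
    obtain ⟨Ψ, hΨ⟩ := hex.exists_desc (homEval _ B I t) (by
      ext ⟨_, k, rfl⟩
      exact LinearMap.congr_fun ht k)
    obtain ⟨Φ, hΦ⟩ := hI.out (LinearMap.range (g.lcomp R B)).subtype Subtype.val_injective Ψ
    obtain ⟨s, rfl⟩ := (homEval_bijective_pi m B I).2 Φ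
    have : t = g.lTensor _ s := by
      apply (homEval_bijective_pi n B I).1
      rw [homEval_lTensor, ← hΨ]
      exact LinearMap.ext fun k => (hΦ _).symm
    rw [this]
    exact (lTensor_exact (B →ₗ[R] I) hgf hf).apply_apply_eq_zero s
  · intro Φ
    obtain ⟨Ψ, hΨ⟩ := hI.out _ hfinj Φ
    obtain ⟨t, rfl⟩ := (homEval_bijective_pi n B I).2 Ψ
    exact ⟨f.lTensor _ t, LinearMap.ext fun k => by rw [homEval_lTensor]; exact hΨ k⟩

end FinitelyPresented

/-! ### The Bass class -/

section BassClass

variable {R : Type u} [CommRing R] {C : Type u} [AddCommGroup C] [Module R C]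

theorem bass_iff {N : ModuleCat.{u} R} : Bass R C N ↔ ExtAcyclic R C N ∧
    TorAcyclic R C (C →ₗ[R] N) ∧ Function.Bijective (evalMap R C N) := by
  rw [← isZero_tor_iff]; rfl

@[simp]
theorem evalMap_tmul {N : Type u} [AddCommGroup N] [Module R N] (c : C) (f : C →ₗ[R] N) :
    evalMap R C N (c ⊗ₜ f) = f c := rfl

theorem evalMap_lTensor {N N' : Type u} [AddCommGroup N] [Module R N] [AddCommGroup N']
    [Module R N'] (g : N →ₗ[R] N') (t : C ⊗[R] (C →ₗ[R] N)) :
    evalMap R C N' ((g.compRight R).lTensor C t) = g (evalMap R C N t) := by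
  induction t with
  | zero => simp
  | add x y hx hy => simp only [map_add, hx, hy]
  | tmul c f => rfl

namespace ShortEx

variable {X Y Z : Type u} [AddCommGroup X] [Module R X] [AddCommGroup Y] [Module R Y]
  [AddCommGroup Z] [Module R Z] {f : X →ₗ[R] Y} {g : Y →ₗ[R] Z}

theorem evalMap_right_surjective (h : ShortEx f g)
    (hY : Function.Surjective (evalMap R C Y)) :
    Function.Surjective (evalMap R C Z) := by
  intro z
  obtain ⟨y, rfl⟩ := h.surj z
  obtain ⟨t, rfl⟩ := hY y
  exact ⟨_, evalMap_lTensor g t⟩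

theorem evalMap_right_injective (h : ShortEx f g)
    (hl : ∀ k : C →ₗ[R] Z, ∃ l : C →ₗ[R] Y, g ∘ₗ l = k)
    (hX : Function.Surjective (evalMap R C X))
    (hY : Function.Injective (evalMap R C Y)) : Function.Injective (evalMap R C Z) := by
  rw [injective_iff_map_eq_zero]
  intro t ht
  obtain ⟨t, rfl⟩ := LinearMap.lTensor_surjective C (h.hom hl).surj t
  rw [evalMap_lTensor] at ht
  obtain ⟨x, hx⟩ := (h.exact _).1 ht
  obtain ⟨s, rfl⟩ := hX x
  rw [← evalMap_lTensor] at hx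
  rw [← hY hx]
  exact (lTensor_exact C (h.hom hl).exact (h.hom hl).surj).apply_apply_eq_zero s

/-- Followed by evaluation at Y, the map equals f after evaluation at X, which is injective. This
replaces a separate Tor₁ computation. -/
theorem lTensor_compRight_injective (h : ShortEx f g)
    (hX : Function.Bijective (evalMap R C X)) :
    Function.Injective ((f.compRight R : (C →ₗ[R] X) →ₗ[R] C →ₗ[R] Y).lTensor C) := by
  intro s t hst
  have := congrArg (evalMap R C Y) hst
  rw [evalMap_lTensor, evalMap_lTensor] at this
  exact hX.1 (h.inj this)

end ShortEx

theorem ShortEx.bass_right {X Y Z : ModuleCat.{u} R} {f : X →ₗ[R] Y} {g : Y →ₗ[R] Z} (h : ShortEx f g)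
    (hX : Bass R C X) (hY : Bass R C Y) : Bass R C Z := by
  rw [bass_iff] at *
  have hl := h.lifting hX.1
  exact ⟨h.extAcyclic_right hX.1 hY.1, (h.hom hl).torAcyclic_right hX.2.1 hY.2.1
    (h.lTensor_compRight_injective hX.2.2), h.evalMap_right_injective hl hX.2.2.2 hY.2.2.1,
    h.evalMap_right_surjective hY.2.2.2⟩

end BassClass

/-! ### Consequences of the semidualizing axioms -/

section Semidualizing

variable {R : Type u} [CommRing R] {C : Type u} [AddCommGroup C] [Module R C]

namespace IsSemidualizing

variable (hC : IsSemidualizing R C)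

include hC

theorem exists_fp_resolution : ∃ (K P : ℕ → ModuleCat.{u} R) (ι : ∀ n, K (n + 1) →ₗ[R] P n)
    (π : ∀ n, P n →ₗ[R] K n), K 0 = ModuleCat.of R C ∧ (∀ n, ShortEx (ι n) (π n)) ∧
      (∀ n, Module.Projective R (P n)) ∧ (∀ n, Module.Finite R (P n)) ∧
      (∀ n, Module.FinitePresentation R (K n)) ∧ ∀ n, ExtAcyclic R (K n) C := by
  obtain ⟨P, hP⟩ := hC.exists_resolution
  obtain ⟨K, ι, π, hK, hs, -⟩ := exists_syzygies P
  have hpr : ∀ n, Module.Projective R (P.complex.X n) := fun n =>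
    (IsProjective.iff_projective _).2 (P.projective n)
  have hfin : ∀ n, Module.Finite R (K n) := fun n =>
    have := hP n
    Module.Finite.of_surjective (π n) (hs n).surj
  refine ⟨K, P.complex.X, ι, π, hK, hs, hpr, hP, fun n => ?_, fun n => ?_⟩
  · have := hP n
    have := hpr n
    have := hfin (n + 1)
    have : Module.FinitePresentation R (P.complex.X n) :=
      Module.finitePresentation_of_projective _ _
    refine Module.finitePresentation_of_surjective (π n) (hs n).surj ?_
    rw [(hs n).exact.linearMap_ker_eq, LinearMap.range_eq_map]
    exact Module.Finite.fg_top.map _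
  · induction n with
    | zero => rw [hK]; exact hC.ext_eq_zero
    | succ n ih =>
      have := hpr n
      exact (hs n).extAcyclic_source_left (.of_projective _ _) ih

theorem finitePresentation : Module.FinitePresentation R C := by
  obtain ⟨K, P, ι, π, hK, -, -, -, h, -⟩ := hC.exists_fp_resolution
  have := h 0
  rwa [hK] at this

/-- A map from a syzygy K to F ⊗ C is an element of F ⊗ Hom(K, C), by finite presentation; it
extends to the projective because maps K → C do, by Ext(C, C) = 0. -/
theorem extAcyclic_tensor (F : Type u) [AddCommGroup F] [Module R F] [Module.Flat R F] :
    ExtAcyclic R C (C ⊗[R] F) := by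
  refine ExtAcyclic.congr_right ?_ (TensorProduct.comm R F C)
  obtain ⟨K, P, ι, π, hK, hs, hpr, -, hfp, hE⟩ := hC.exists_fp_resolution
  suffices h : ∀ n, ExtAcyclic R (K n) (F ⊗[R] C) by
    have := h 0
    rwa [hK] at this
  intro n
  refine ExtAcyclic.of_resolving (fun Z => ∃ n, Z = K n) ?_ _ ⟨n, rfl⟩
  rintro _ ⟨n, rfl⟩
  have := hpr n
  refine ⟨_, _, _, _, hs n, .of_projective _ _, fun k => ?_, n + 1, rfl⟩
  have := hfp (n + 1)
  obtain ⟨t, rfl⟩ := (lTensorHomToHomLTensor_bijective F (K (n + 1)) C).2 k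
  have hsurj : Function.Surjective ((ι n).lcomp R C) := (hs n).extend (hE n)
  obtain ⟨s, rfl⟩ := LinearMap.lTensor_surjective F hsurj t
  refine ⟨lTensorHomToHomLTensor (.id R) _ F C s, ?_⟩
  induction s with
  | zero => simp
  | add x y hx hy => simp only [map_add, LinearMap.add_comp, hx, hy]
  | tmul x y => rfl

/-- Dual argument: Hom(C, I) ⊗ K ≅ Hom(Hom(K, C), I) for each syzygy K, and restriction of maps into
C from the projective to K is onto, so its I-dual is injective. -/
theorem torAcyclic_hom (I : Type u) [AddCommGroup I] [Module R I] [hI : Module.Injective R I] :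
    TorAcyclic R C (C →ₗ[R] I) := by
  refine TorAcyclic.symm ?_
  obtain ⟨K, P, ι, π, hK, hs, hpr, -, hfp, hE⟩ := hC.exists_fp_resolution
  suffices h : ∀ n, TorAcyclic R (C →ₗ[R] I) (K n) by
    have := h 0
    rwa [hK] at this
  intro n
  refine TorAcyclic.of_resolving (fun Z => ∃ n, Z = K n) ?_ _ ⟨n, rfl⟩
  rintro _ ⟨n, rfl⟩
  have := hpr n
  refine ⟨_, _, _, _, hs n, .of_flat _ _, ?_, n + 1, rfl⟩
  have := hfp (n + 1)
  intro s t hst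
  have := congrArg (homEval _ C I) hst
  rw [homEval_lTensor, homEval_lTensor] at this
  apply (homEval_bijective (K (n + 1)) C I).1
  refine LinearMap.ext fun k => ?_
  obtain ⟨l, rfl⟩ := (hs n).extend (hE n) k
  exact LinearMap.congr_fun this l

/-- C ⊗ Hom(C, I) ≅ Hom(Hom(C, C), I) ≅ Hom(R, I) ≅ I. -/
theorem evalMap_injective_bijective (I : Type u) [AddCommGroup I] [Module R I]
    [hI : Module.Injective R I] : Function.Bijective (evalMap R C I) := by
  have := hC.finitePresentation
  let e : R ≃ₗ[R] (C →ₗ[R] C) := .ofBijective _ hC.homothety_bijective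
  have h : ∀ t, evalMap R C I t = homEval C C I (TensorProduct.comm R C _ t) (e 1) := by
    intro t
    induction t with
    | zero => simp
    | add x y hx hy => simp only [map_add, hx, hy, LinearMap.add_apply]
    | tmul c f => simp [e]
  have h' : ⇑(evalMap R C I) = ⇑(((LinearMap.ringLmapEquivSelf R R I).toLinearMap ∘ₗ
      (e.arrowCongr (.refl R I)).symm.toLinearMap) ∘ₗ homEval C C I ∘ₗ
      (TensorProduct.comm R C _).toLinearMap) := by
    funext t
    rw [h]
    simp
  rw [h']
  simp only [LinearMap.coe_comp, LinearEquiv.coe_coe]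
  exact ((LinearEquiv.bijective _).comp (LinearEquiv.bijective _)).comp
    ((homEval_bijective C C I).comp (LinearEquiv.bijective _))

/-- The unit `F → Hom(C, C ⊗ F)` is bijective for flat `F`. -/
theorem unit_bijective (F : Type u) [AddCommGroup F] [Module R F] [Module.Flat R F] :
    Function.Bijective ((TensorProduct.mk R C F).flip) := by
  have := hC.finitePresentation
  let e : R ≃ₗ[R] (C →ₗ[R] C) := .ofBijective _ hC.homothety_bijective
  have h : ⇑((TensorProduct.mk R C F).flip) = ⇑(((LinearEquiv.refl R C).arrowCongr
      (TensorProduct.comm R F C)).toLinearMap ∘ₗ lTensorHomToHomLTensor (.id R) C F C ∘ₗ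
      (e.lTensor F).toLinearMap ∘ₗ (TensorProduct.rid R F).symm.toLinearMap) := by
    funext x
    ext c
    simp [e]
  rw [h]
  simp only [LinearMap.coe_comp, LinearEquiv.coe_coe]
  exact (LinearEquiv.bijective _).comp ((lTensorHomToHomLTensor_bijective F C C).comp
    ((LinearEquiv.bijective _).comp (LinearEquiv.bijective _)))

/-- `Hom(C, C ⊗ F) ≅ F` for flat `F`. -/
theorem exists_equiv_hom_tensor (F : Type u) [AddCommGroup F] [Module R F] [Module.Flat R F] :
    ∃ e : F ≃ₗ[R] (C →ₗ[R] C ⊗[R] F), ∀ x c, e x c = c ⊗ₜ x :=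
  ⟨.ofBijective _ (hC.unit_bijective F), fun _ _ => rfl⟩

theorem bass_tensor (F : Type u) [AddCommGroup F] [Module R F] [Module.Flat R F] :
    Bass R C (ModuleCat.of R (C ⊗[R] F)) := by
  obtain ⟨e, he⟩ := hC.exists_equiv_hom_tensor F
  refine bass_iff.2 ⟨hC.extAcyclic_tensor F, .congr_right (.of_flat C F) e, ?_⟩
  have h : evalMap R C (C ⊗[R] F) ∘ₗ (e.lTensor C).toLinearMap = LinearMap.id :=
    TensorProduct.ext' fun c x => he x c
  have h' : ⇑(evalMap R C (C ⊗[R] F)) = (e.lTensor C).symm := by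
    funext t
    obtain ⟨s, rfl⟩ := (e.lTensor C).surjective t
    rw [LinearEquiv.symm_apply_apply]
    exact LinearMap.congr_fun h s
  change Function.Bijective (evalMap R C (C ⊗[R] F))
  rw [h']
  exact (e.lTensor C).symm.bijective

/-- Hom(C ⊗ F, J) ≅ Hom(C, Hom(F, J)) with Hom(F, J) injective, which reduces the claim to F = R. -/
theorem torAcyclic_cinjective_tensor {U : ModuleCat.{u} R} (hU : CInjective R C U)
    (F : Type u) [AddCommGroup F] [Module R F] [Module.Flat R F] :
    TorAcyclic R U (C ⊗[R] F) := by
  obtain ⟨I, hI, ⟨e⟩⟩ := hU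
  refine TorAcyclic.congr_left ?_ e.symm
  intro J _ _ _
  refine ExtAcyclic.congr_right ?_ (TensorProduct.lift.equiv (.id R) C F J)
  exact (hC.torAcyclic_hom I).symm (F →ₗ[R] J)

end IsSemidualizing

end Semidualizing

/-! ### Foxby equivalence -/

section Foxby

variable {R : Type u} [CommRing R] {C : Type u} [AddCommGroup C] [Module R C]

theorem Bass.congr {X Y : ModuleCat.{u} R} (h : Bass R C X) (e : X ≃ₗ[R] Y) : Bass R C Y := by
  rw [bass_iff] at *
  have h0 : Function.Injective (0 : PUnit.{u + 1} →ₗ[R] X) := fun _ _ _ => rfl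
  have hs : ShortEx (0 : PUnit.{u + 1} →ₗ[R] X) e.toLinearMap :=
    ⟨h0, fun x => by simp [eq_comm (a := (0 : X))], e.surjective⟩
  exact ⟨h.1.congr_right e, h.2.1.congr_right (e.congrRight),
    hs.evalMap_right_injective (fun k => ⟨e.symm.toLinearMap ∘ₗ k, by ext; simp⟩)
      (fun _ => ⟨0, rfl⟩) h.2.2.1, hs.evalMap_right_surjective h.2.2.2⟩

theorem relGF_of_flat (𝒰 : ModuleCat.{u} R → Prop) (F : ModuleCat.{u} R) [Module.Flat R F] :
    RelGF 𝒰 (fun F => Module.Flat R F) F := by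
  refine ⟨fun F => Module.Flat R F, inferInstance, fun A hA => ⟨fun _ _ => .of_flat _ _,
    A, ModuleCat.of R PUnit.{u + 1}, LinearMap.id, 0, ⟨Function.injective_id, fun x => by simp,
      fun _ => ⟨0, rfl⟩⟩, hA, inferInstanceAs (Module.Flat R PUnit.{u + 1})⟩⟩

variable (R C) in
/-- The test class consisting of the injective modules and `C`. -/
def InjOrSelf (U : ModuleCat.{u} R) : Prop := Module.Injective R U ∨ U = ModuleCat.of R C

namespace IsSemidualizing

variable (hC : IsSemidualizing R C)

include hC

/-- `Hom(C, I) ⊗ (C ⊗ X) ≅ I ⊗ X` for injective `I`. -/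
theorem exists_equiv_tensor_tensor (I : Type u) [AddCommGroup I] [Module R I]
    [Module.Injective R I] : ∃ e : ∀ (X : Type u) [AddCommGroup X] [Module R X],
      (C →ₗ[R] I) ⊗[R] (C ⊗[R] X) ≃ₗ[R] I ⊗[R] X, ∀ (X : Type u) [AddCommGroup X] [Module R X]
        (φ : C →ₗ[R] I) (c : C) (x : X), e X (φ ⊗ₜ (c ⊗ₜ x)) = φ c ⊗ₜ x := by
  let e₀ : (C →ₗ[R] I) ⊗[R] C ≃ₗ[R] I := (TensorProduct.comm R _ C).trans
    (.ofBijective _ (hC.evalMap_injective_bijective I))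
  exact ⟨fun X _ _ => (TensorProduct.assoc R _ C X).symm.trans (e₀.rTensor X),
    fun X _ _ φ c x => by simp [e₀]⟩

theorem lTensor_lTensor_injective_iff (I : Type u) [AddCommGroup I] [Module R I]
    [Module.Injective R I] {X Y : Type u} [AddCommGroup X] [Module R X] [AddCommGroup Y]
    [Module R Y] (f : X →ₗ[R] Y) :
    Function.Injective ((f.lTensor C).lTensor (C →ₗ[R] I)) ↔
      Function.Injective (f.lTensor I) := by
  obtain ⟨e, he⟩ := hC.exists_equiv_tensor_tensor I
  have h : f.lTensor I ∘ₗ (e X).toLinearMap =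
      (e Y).toLinearMap ∘ₗ (f.lTensor C).lTensor (C →ₗ[R] I) :=
    TensorProduct.ext' fun φ t => by
      induction t with
      | zero => simp
      | add x y hx hy => simp only [TensorProduct.tmul_add, map_add, hx, hy]
      | tmul c x => simp [he]
  rw [← (e X).injective_comp, ← (e Y).comp_injective]
  exact iff_of_eq (congrArg Function.Injective (congrArg DFunLike.coe h)) |>.symm

/-- Since Tor(C, A) = 0, C ⊗ - turns a free resolution of A into a resolution of C ⊗ A by Hom(C, I)
⊗ --acyclic modules. Applying Hom(C, I) ⊗ - gives I ⊗ - of the original resolution. The next lemma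
is the converse. -/
theorem torAcyclic_of_hom {A I : Type u} [AddCommGroup A] [Module R A] [AddCommGroup I]
    [Module R I] [Module.Injective R I] (hA : TorAcyclic R C A)
    (hA' : TorAcyclic R (C →ₗ[R] I) (C ⊗[R] A)) : TorAcyclic R I A := by
  refine TorAcyclic.of_resolving (fun A => TorAcyclic R C A ∧
    TorAcyclic R (C →ₗ[R] I) (C ⊗[R] A)) ?_ (ModuleCat.of R A) ⟨hA, hA'⟩
  rintro A ⟨hA, hA'⟩
  obtain ⟨K, P, f, g, hs, hP⟩ := exists_free_presentation (R := R) A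
  have hs' := hs.lTensor (hs.lTensor_injective hA)
  exact ⟨P, K, f, g, hs, .of_flat _ _,
    (hC.lTensor_lTensor_injective_iff I f).1 (hs'.lTensor_injective hA'),
    hs.torAcyclic_left (.of_flat _ _) hA, hs'.torAcyclic_left (hC.torAcyclic_cinjective_tensor
      (U := ModuleCat.of R (C →ₗ[R] I)) ⟨ModuleCat.of R I, ‹_›, ⟨.refl R _⟩⟩ P) hA'⟩

theorem torAcyclic_hom_tensor {A I : Type u} [AddCommGroup A] [Module R A] [AddCommGroup I]
    [Module R I] [Module.Injective R I] (hA : TorAcyclic R C A)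
    (hA' : TorAcyclic R I A) : TorAcyclic R (C →ₗ[R] I) (C ⊗[R] A) := by
  refine TorAcyclic.of_resolving (fun B => ∃ A : ModuleCat.{u} R, TorAcyclic R C A ∧
    TorAcyclic R I A ∧ B = ModuleCat.of R (C ⊗[R] A)) ?_ _ ⟨ModuleCat.of R A, hA, hA', rfl⟩
  rintro _ ⟨A, hA, hA', rfl⟩
  obtain ⟨K, P, f, g, hs, hP⟩ := exists_free_presentation (R := R) A
  exact ⟨ModuleCat.of R (C ⊗[R] P), ModuleCat.of R (C ⊗[R] K), _, _,
    hs.lTensor (hs.lTensor_injective hA), hC.torAcyclic_cinjective_tensor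
      (U := ModuleCat.of R (C →ₗ[R] I)) ⟨ModuleCat.of R I, ‹_›, ⟨.refl R _⟩⟩ P,
    (hC.lTensor_lTensor_injective_iff I f).2 (hs.lTensor_injective hA'), K,
    hs.torAcyclic_left (.of_flat _ _) hA, hs.torAcyclic_left (.of_flat _ _) hA', rfl⟩

theorem gcFlat_iff {N : ModuleCat.{u} R} :
    GCFlat R C N ↔ RelGF (CInjective R C) (CFlat R C) N := by
  constructor
  · rintro ⟨S, h0, h1, hN, hU⟩
    refine S.relGF (fun i U h => ?_) h1 hU hN
    rcases le_or_gt i 0 with hi | hi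
    · have := h0 i hi
      exact .of_flat _ _
    · obtain ⟨F, hF, ⟨e⟩⟩ := h1 i hi
      exact (hC.torAcyclic_cinjective_tensor h F).congr_right e.symm
  · exact RelGF.exists_exactSeq

theorem torAcyclic_hom_of_bass {N : ModuleCat.{u} R} (hB : Bass R C N)
    (hN : ∀ U, CInjective R C U → TorAcyclic R U N) {U : ModuleCat.{u} R}
    (hU : InjOrSelf R C U) : TorAcyclic R U (C →ₗ[R] N) := by
  rw [bass_iff] at hB
  rcases hU with hU | rfl
  · refine hC.torAcyclic_of_hom hB.2.1 ?_
    exact (hN (ModuleCat.of R (C →ₗ[R] U)) ⟨U, hU, ⟨.refl R _⟩⟩).congr_right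
      (LinearEquiv.ofBijective _ hB.2.2).symm
  · exact hB.2.1

/-- Foxby equivalence: `N` in the Bass class is `G_C`-flat if and only if `Hom(C, N)` is
Gorenstein flat relative to the injective modules and `C`. -/
theorem gcFlat_iff_relGF_hom {N : ModuleCat.{u} R} (hB : Bass R C N) :
    GCFlat R C N ↔
      RelGF (InjOrSelf R C) (fun F => Module.Flat R F) (ModuleCat.of R (C →ₗ[R] N)) := by
  rw [hC.gcFlat_iff]
  constructor
  · intro hN
    refine ⟨fun A => ∃ N, RelGF (CInjective R C) (CFlat R C) N ∧ Bass R C N ∧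
      A = ModuleCat.of R (C →ₗ[R] N), ⟨N, hN, hB, rfl⟩, ?_⟩
    rintro _ ⟨N, hN, hB, rfl⟩
    refine ⟨fun U hU => hC.torAcyclic_hom_of_bass hB (fun U hU => hN.torAcyclic hU) hU, ?_⟩
    -- The cosyzygy `N₁` stays in the Bass class, as a quotient of Bass modules with Bass kernel, so
    -- the invariant persists; Hom(C, C ⊗ F) ≅ F makes the new middle term flat.
    obtain ⟨V, N₁, f, g, hs, ⟨F, hF, ⟨e⟩⟩, hN₁⟩ := hN.exists_shortEx
    have hs' := hs.equiv_mid e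
    have hl := hs'.lifting (bass_iff.1 hB).1
    refine ⟨ModuleCat.of R (C →ₗ[R] C ⊗[R] F), ModuleCat.of R (C →ₗ[R] N₁), _, _, hs'.hom hl,
      .of_linearEquiv (LinearEquiv.ofBijective _ (hC.unit_bijective F)).symm, N₁, hN₁,
      ShortEx.bass_right (Y := ModuleCat.of R (C ⊗[R] F)) hs' hB (hC.bass_tensor F), rfl⟩
  · intro hN
    refine RelGF.congr (N := ModuleCat.of R (C ⊗[R] (C →ₗ[R] N))) ?_
      (LinearEquiv.ofBijective _ (bass_iff.1 hB).2.2)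
    refine ⟨fun B => ∃ A, RelGF (InjOrSelf R C) (fun F => Module.Flat R F) A ∧
      B = ModuleCat.of R (C ⊗[R] A), ⟨_, hN, rfl⟩, ?_⟩
    rintro _ ⟨A, hA, rfl⟩
    refine ⟨?_, ?_⟩
    · rintro U ⟨I, hI, ⟨e⟩⟩
      exact (hC.torAcyclic_hom_tensor (hA.torAcyclic (.inr rfl))
        (hA.torAcyclic (.inl hI))).congr_left e.symm
    · obtain ⟨F, K, f, g, hs, hF, hK⟩ := hA.exists_shortEx
      exact ⟨ModuleCat.of R (C ⊗[R] F), ModuleCat.of R (C ⊗[R] K), _, _,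
        hs.lTensor (hs.lTensor_injective (hK.torAcyclic (.inr rfl))),
        ⟨F, hF, ⟨.refl R _⟩⟩, K, hK, rfl⟩

theorem gcFlat_tensor (F : Type u) [AddCommGroup F] [Module R F] [Module.Flat R F] :
    GCFlat R C (ModuleCat.of R (C ⊗[R] F)) :=
  (hC.gcFlat_iff_relGF_hom (hC.bass_tensor F)).2 <|
    (relGF_of_flat _ (ModuleCat.of R F)).congr (LinearEquiv.ofBijective _ (hC.unit_bijective F))

end IsSemidualizing

namespace ExactSeq

theorem comp_eq_zero (S : ExactSeq R) (i : ℤ) : S.d (i + 1) ∘ₗ S.d i = 0 :=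
  LinearMap.ext fun x => (S.exact i).apply_apply_eq_zero x

theorem TensorExact.of_retract {S : ExactSeq R} {A B : Type u} [AddCommGroup A] [Module R A]
    [AddCommGroup B] [Module R B] (h : S.TensorExact B) (s : A →ₗ[R] B) (r : B →ₗ[R] A)
    (hrs : r ∘ₗ s = LinearMap.id) : S.TensorExact A := by
  have comm : ∀ {A B X Y : Type u} [AddCommGroup A] [Module R A] [AddCommGroup B] [Module R B]
      [AddCommGroup X] [Module R X] [AddCommGroup Y] [Module R Y] (s : A →ₗ[R] B)
      (f : X →ₗ[R] Y) (t : A ⊗[R] X),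
      s.rTensor Y (f.lTensor A t) = f.lTensor B (s.rTensor X t) := by
    intro A B X Y _ _ _ _ _ _ _ _ s f t
    rw [← LinearMap.comp_apply, ← LinearMap.comp_apply, LinearMap.rTensor_comp_lTensor,
      LinearMap.lTensor_comp_rTensor]
  intro i y
  constructor
  · intro hy
    obtain ⟨x, hx⟩ := (h i (s.rTensor _ y)).1 (by rw [← comm, hy, map_zero])
    refine ⟨r.rTensor _ x, ?_⟩
    rw [← comm, hx, ← LinearMap.comp_apply, ← LinearMap.rTensor_comp, hrs,
      LinearMap.rTensor_id, LinearMap.id_apply]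
  · rintro ⟨x, rfl⟩
    rw [← LinearMap.comp_apply, ← LinearMap.lTensor_comp, S.comp_eq_zero, LinearMap.lTensor_zero,
      LinearMap.zero_apply]

theorem HomExact.congr {S : ExactSeq R} {A B : Type u} [AddCommGroup A] [Module R A]
    [AddCommGroup B] [Module R B] (h : S.HomExact A) (e : A ≃ₗ[R] B) : S.HomExact B := by
  intro i k
  constructor
  · intro hk
    obtain ⟨l, hl⟩ := (h i (k ∘ₗ e.toLinearMap)).1
      (LinearMap.ext fun a => LinearMap.congr_fun hk (e a))
    refine ⟨l ∘ₗ e.symm.toLinearMap, LinearMap.ext fun b => ?_⟩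
    simpa using LinearMap.congr_fun hl (e.symm b)
  · rintro ⟨l, rfl⟩
    exact LinearMap.ext fun b => (S.exact i).apply_apply_eq_zero (l b)

end ExactSeq

/-- Every injective module is a retract of the character module of a free module. -/
theorem exists_retract_characterModule (I : Type u) [AddCommGroup I] [Module R I]
    [hI : Module.Injective R I] : ∃ (F : ModuleCat.{u} R) (s : I →ₗ[R] CharacterModule F)
      (r : CharacterModule F →ₗ[R] I), Module.Free R F ∧ r ∘ₗ s = LinearMap.id := by
  -- I embeds into I⁺⁺, and a free cover of I⁺ dualizes to an embedding of I⁺⁺ into F⁺. Injectivity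
  -- of I splits the composite.
  let ev : I →ₗ[R] CharacterModule (CharacterModule I) :=
    { toFun x := ⟨⟨fun c => c x, rfl⟩, fun _ _ => rfl⟩
      map_add' x y := CharacterModule.ext _ fun c => map_add c x y
      map_smul' a x := CharacterModule.ext _ fun c => rfl }
  have hev : Function.Injective ev := by
    rw [injective_iff_map_eq_zero]
    exact fun x hx => CharacterModule.eq_zero_of_character_apply fun c => DFunLike.congr_fun hx c
  let p := Finsupp.linearCombination R (id : CharacterModule I → CharacterModule I)
  have hp : Function.Injective (CharacterModule.dual p) :=
    CharacterModule.dual_injective_of_surjective _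
      (Finsupp.linearCombination_id_surjective R (CharacterModule I))
  let s := CharacterModule.dual p ∘ₗ ev
  obtain ⟨r, hr⟩ := hI.out s (hp.comp hev) LinearMap.id
  exact ⟨ModuleCat.of R (CharacterModule I →₀ R), s, r,
    inferInstanceAs (Module.Free R (CharacterModule I →₀ R)), LinearMap.ext hr⟩

namespace ExactSeq

variable (S : ExactSeq R)

/-- If the Bass class contains all terms of an exact sequence that stays exact under
`Hom(C, -)`, then it contains all images. -/
theorem bass_range (hX : ∀ i, Bass R C (S.X i)) (hS : S.HomExact C) (i : ℤ) :
    Bass R C (ModuleCat.of R (LinearMap.range (S.d i))) := by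
  have hpred : ∀ i : ℤ, ∃ j, i = j + 1 := fun i => ⟨i - 1, by ring⟩
  have hE : ∀ i, ExtAcyclic R C (LinearMap.range (S.d i)) := fun i => by
    refine ExtAcyclic.of_coresolving
      (fun Z => ∃ i, Z = ModuleCat.of R (LinearMap.range (S.d i))) ?_ _ ⟨i, rfl⟩
    rintro _ ⟨i, rfl⟩
    exact ⟨_, ModuleCat.of R (LinearMap.range (S.d (i + 1))), _, _, S.shortEx i,
      (bass_iff.1 (hX _)).1, S.range_lifting hS i, i + 1, rfl⟩
  -- Surjectivity is settled for all images first, because injectivity at one image uses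
  -- surjectivity at its left neighbour.
  have hsurj : ∀ i, Function.Surjective (evalMap R C (LinearMap.range (S.d i))) := fun i => by
    obtain ⟨j, rfl⟩ := hpred i
    exact (S.shortEx j).evalMap_right_surjective (bass_iff.1 (hX _)).2.2.2
  have hbij : ∀ i, Function.Bijective (evalMap R C (LinearMap.range (S.d i))) := fun i => by
    obtain ⟨j, rfl⟩ := hpred i
    exact ⟨(S.shortEx j).evalMap_right_injective (S.range_lifting hS j) (hsurj j)
      (bass_iff.1 (hX _)).2.2.1, hsurj _⟩
  refine bass_iff.2 ⟨hE i, ?_, hbij i⟩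
  refine TorAcyclic.of_resolving
    (fun Z => ∃ i, Z = ModuleCat.of R (C →ₗ[R] LinearMap.range (S.d i))) ?_ _ ⟨i, rfl⟩
  rintro _ ⟨i, rfl⟩
  obtain ⟨j, rfl⟩ := hpred i
  exact ⟨ModuleCat.of R (C →ₗ[R] S.X (j + 1)),
    ModuleCat.of R (C →ₗ[R] LinearMap.range (S.d j)), _, _,
    (S.shortEx j).hom (S.range_lifting hS j), (bass_iff.1 (hX _)).2.1,
    (S.shortEx j).lTensor_compRight_injective (hbij j), j, rfl⟩

end ExactSeq

/-! ### Stability of the intersection class -/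

theorem mem_of_gorStep (hR : IsGFClosed R) (hC : IsSemidualizing R C) {M : ModuleCat.{u} R}
    (hM : gorStep (GCFlat R C ⊓ Bass R C) M) : GCFlat R C M ∧ Bass R C M := by
  obtain ⟨S, hX, ⟨e⟩, hHom, hTen⟩ := hM
  have hF : ∀ (F : Type u) [AddCommGroup F] [Module R F] [Module.Flat R F],
      (GCFlat R C ⊓ Bass R C) (ModuleCat.of R (C ⊗[R] F)) :=
    fun F _ _ _ => ⟨hC.gcFlat_tensor F, hC.bass_tensor F⟩
  have hSC : S.HomExact C := (hHom _ (hF R)).congr (TensorProduct.rid R C)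
  have hU : ∀ U, CInjective R C U → S.TensorExact U := by
    rintro U ⟨I, hI, ⟨e⟩⟩
    obtain ⟨F, s, r, hFree, hrs⟩ := exists_retract_characterModule (R := R) I
    -- Adjunction (C ⊗ F)⁺ ≅ Hom(C, F⁺): the C-injective `U` becomes a retract of the character
    -- module of a member of the class.
    let c := (CharacterModule.homEquiv (R := R) (A := C) (B := F))
    refine (hTen _ (hF F)).of_retract (c.toLinearMap ∘ₗ s.compRight R ∘ₗ e.toLinearMap)
      (e.symm.toLinearMap ∘ₗ r.compRight R ∘ₗ c.symm.toLinearMap) (LinearMap.ext fun u => ?_)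
    have : r ∘ₗ s ∘ₗ e u = e u := by rw [← LinearMap.comp_assoc, hrs, LinearMap.id_comp]
    simp [this]
  have hB := S.bass_range (fun i => (hX i).2) hSC
  have hT : ∀ i U, CInjective R C U → TorAcyclic R U (LinearMap.range (S.d i)) := fun i U h =>
    S.torAcyclic_range (hU U h) i
      (fun j _ => (hC.gcFlat_iff.1 (hX j).1).torAcyclic h) i le_rfl
  -- GF-closedness enters here. Applying Hom(C, -) to the short pieces of `S` coresolves each Hom(C,
  -- image) by modules of the relative class.
  have hG : RelGF (InjOrSelf R C) (fun F => Module.Flat R F)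
      (ModuleCat.of R (C →ₗ[R] LinearMap.range (S.d 0))) := by
    refine RelGF.of_coresolving (fun X Y Z f g h hX hZ => hR.relGF_mid
      (h𝒰 := fun I hI => .inl hI) h hX hZ)
      (fun Z => ∃ i, Z = ModuleCat.of R (C →ₗ[R] LinearMap.range (S.d i))) ?_ ⟨0, rfl⟩
    rintro _ ⟨i, rfl⟩
    exact ⟨fun U h => hC.torAcyclic_hom_of_bass (hB i) (hT i) h,
      ModuleCat.of R (C →ₗ[R] S.X (i + 1)),
      ModuleCat.of R (C →ₗ[R] LinearMap.range (S.d (i + 1))), _, _,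
      (S.shortEx i).hom (S.range_lifting hSC i),
      (hC.gcFlat_iff_relGF_hom (hX _).2).1 (hX _).1, i + 1, rfl⟩
  exact ⟨hC.gcFlat_iff.2 ((hC.gcFlat_iff.1 ((hC.gcFlat_iff_relGF_hom (hB 0)).2 hG)).congr e.symm),
    (hB 0).congr e.symm⟩

theorem gorStep_eq (hR : IsGFClosed R) (hC : IsSemidualizing R C) :
    gorStep (GCFlat R C ⊓ Bass R C) = GCFlat R C ⊓ Bass R C := by
  ext M
  refine ⟨mem_of_gorStep hR hC, fun hM => ?_⟩
  have : Subsingleton (ModuleCat.of R (C ⊗[R] PUnit.{u + 1})) :=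
    inferInstanceAs (Subsingleton (C ⊗[R] PUnit.{u + 1}))
  exact gorStep_of_mem (O := ModuleCat.of R (C ⊗[R] PUnit.{u + 1}))
    ⟨hC.gcFlat_tensor _, hC.bass_tensor _⟩ hM

end Foxby

end GorFlat

theorem corollary4p6 (R : Type u) [CommRing R] (hR : GorFlat.IsGFClosed R)
    (C : Type u) [AddCommGroup C] [Module R C] (hC : GorFlat.IsSemidualizing R C)
    (n : ℕ) (hn : 1 ≤ n) :
    GorFlat.gorIter (GorFlat.GCFlat R C ⊓ GorFlat.Bass R C) n =
      GorFlat.GCFlat R C ⊓ GorFlat.Bass R C := by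
  induction n, hn using Nat.le_induction with
  | base => rfl
  | succ n hn ih =>
    obtain ⟨n, rfl⟩ := Nat.exists_eq_add_of_le' hn
    rw [GorFlat.gorIter, ih, GorFlat.gorStep_eq hR hC]
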